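/- Let $r>a>0$ be coprime integers and let $X=\mathbb{C}^3_{(x,y,z)}/\frac1r(a,-a,1)=\operatorname{Spec}\mathbb{C}[x,y,z]^{\mu_r}$ be the terminal cyclic quotient singularity, where a generator of $\mu_r$ acts by $(x,y,z)\mapsto(\xi^{a}x,\xi^{-a}y,\xi z)$ with $\xi=e^{2\pi i/r}$. Let $f\colon Y\to X$ be the economic resolution, i.e. the toric morphism obtained by the weighted blow-up of the singular point with weight $\frac1r(a,r-a,1)$, followed by the same construction at the resulting cyclic quotient points, of types $\frac1a(-r,r,1)$ and $\frac1{r-a}(r,-r,1)$ (with the entries $\mp r$, $\pm r$ reduced modulo the index), until all charts are smooth. For an integer $n$ write $\overline{n}=n-\lfloor n/r\rfloor r\in\{0,\dots,r-1\}$. Then there are exactly $r-1$ prime divisors on $Y$ that are exceptional over $X$, and they can be labelled $E_1,\dots,E_{r-1}$ so that for each $i=1,\dots,r-1$: 1. the discrepancy of $E_i$ is $a(X,E_i)=\frac ir$, where $K_Y=f^*K_X+\sum_i a(X,E_i)E_i$; 2. $E_i$ corresponds to the monomial valuation with $v_i(x,y,z)=\frac1r(\overline{ia},\overline{-ia},i)$,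 that is, for every nonzero invariant polynomial $g=\sum_m c_m x^{m_1}y^{m_2}z^{m_3}\in\mathbb{C}[x,y,z]^{\mu_r}$, $$\operatorname{ord}_{E_i}(f^*g)=\min_{c_m\ne0}\ \frac1r\left(\overline{ia}\,m_1+\overline{-ia}\,m_2+i\,m_3\right).$$ -/

import Mathlib

open CategoryTheory CategoryTheory.Limits AlgebraicGeometry

noncomputable section

namespace CyclicQuotient

/-! ### The quotient `ℂ³ / (1/r)(a, -a, 1)` -/

/-- The numerical conditions on a terminal quotient singularity `(1/r)(a, -a, 1)`: `0 < a < r` and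
`a` is prime to `r` (in particular `r ≥ 2`). -/
class IsTerminalType (r a : ℕ) : Prop where
  pos : 0 < a
  lt : a < r
  coprime : Nat.Coprime a r

/-- The weights `(a, -a, 1)` of the action. -/
def weight (a : ℕ) : Fin 3 → ℤ := ![(a : ℤ), -(a : ℤ), 1]

/-- The action of the generator of the cyclic group of order `r` on `ℂ[x, y, z]`:
each coordinate is multiplied by `ξ ^ weight`, with `ξ = exp (2πi / r)`. -/
def action (r a : ℕ) : MvPolynomial (Fin 3) ℂ →ₐ[ℂ] MvPolynomial (Fin 3) ℂ :=
  MvPolynomial.aeval fun i =>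
    MvPolynomial.C (Complex.exp (2 * Real.pi * Complex.I / r) ^ weight a i) * MvPolynomial.X i

/-- The ring of invariant polynomials. -/
def invariants (r a : ℕ) : Subalgebra ℂ (MvPolynomial (Fin 3) ℂ) :=
  AlgHom.equalizer (action r a) (AlgHom.id ℂ _)

/-- The quotient `X = ℂ³ / (1/r)(a, -a, 1)`. -/
abbrev quotient (r a : ℕ) : Scheme.{0} := Spec (CommRingCat.of (invariants r a))

/-- The structure morphism of `X`. -/
abbrev structX (r a : ℕ) : quotient r a ⟶ Spec (CommRingCat.of ℂ) :=
  Spec.map (CommRingCat.ofHom (algebraMap ℂ (invariants r a)))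

/-! ### The toric charts -/

/-- The pairing of a vector of `ℚ³` with an exponent in `ℤ³`. -/
def pair (v : Fin 3 → ℚ) (m : Fin 3 → ℤ) : ℚ := ∑ i, v i * m i

/-- The lattice `M` of the exponents of invariant Laurent monomials; it is the dual of the lattice
`N = ℤ³ + ℤ (1/r)(a, -a, 1)`. -/
def latticeM (r a : ℕ) : AddSubgroup (Fin 3 → ℤ) where
  carrier := {m | (r : ℤ) ∣ ∑ i, weight a i * m i}
  zero_mem' := by simp
  add_mem' {x y} hx hy := by
    simp only [Set.mem_ofPred_eq, Pi.add_apply, mul_add, Finset.sum_add_distrib] at *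
    exact dvd_add hx hy
  neg_mem' {x} hx := by
    simp only [Set.mem_ofPred_eq, Pi.neg_apply, mul_neg, Finset.sum_neg_distrib] at *
    exact (dvd_neg).2 hx

/-- The monoid `σ^∨ ∩ M` for the cone `σ` spanned by the set `τ` of vectors. -/
def dualMonoid (r a : ℕ) (τ : Set (Fin 3 → ℚ)) : AddSubmonoid (Fin 3 → ℤ) where
  carrier := {m | m ∈ latticeM r a ∧ ∀ v ∈ τ, 0 ≤ pair v m}
  zero_mem' := ⟨zero_mem _, fun v _ => by simp [pair]⟩
  add_mem' {x y} hx hy := ⟨add_mem hx.1 hy.1, fun v hv => by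
    have : pair v (x + y) = pair v x + pair v y := by
      simp [pair, mul_add, Finset.sum_add_distrib]
    rw [this]; exact add_nonneg (hx.2 v hv) (hy.2 v hv)⟩

/-- Laurent polynomials in `x, y, z`. -/
abbrev Laurent : Type := AddMonoidAlgebra ℂ (Fin 3 → ℤ)

/-- The semigroup algebra `ℂ[σ^∨ ∩ M]`, as a subalgebra of the Laurent polynomials. -/
def chartRing (r a : ℕ) (τ : Set (Fin 3 → ℚ)) : Subalgebra ℂ Laurent where
  carrier := {f | ∀ m ∈ f.coeff.support, m ∈ dualMonoid r a τ}
  mul_mem' {f g} hf hg := by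
    intro m hm
    classical
    obtain ⟨x, hx, y, hy, rfl⟩ := Finset.mem_add.1 (AddMonoidAlgebra.support_coeff_mul_subset f g hm)
    exact add_mem (hf x hx) (hg y hy)
  add_mem' {f g} hf hg := by
    intro m hm
    classical
    rcases Finset.mem_union.1 (Finsupp.support_add hm) with h | h
    · exact hf m h
    · exact hg m h
  algebraMap_mem' c := by
    intro m hm
    have : m = 0 := by
      by_contra h
      simp [AddMonoidAlgebra.coe_algebraMap, Ne.symm h] at hm
    rw [this]; exact zero_mem _

lemma pair_add (v : Fin 3 → ℚ) (x y : Fin 3 → ℤ) : pair v (x + y) = pair v x + pair v y := by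
  simp [pair, mul_add, Finset.sum_add_distrib]

lemma pair_neg (v : Fin 3 → ℚ) (x : Fin 3 → ℤ) : pair v (-x) = - pair v x := by
  simp [pair]

lemma pair_nsmul (v : Fin 3 → ℚ) (n : ℕ) (x : Fin 3 → ℤ) : pair v (n • x) = n * pair v x := by
  simp only [pair, Finset.mul_sum]
  refine Finset.sum_congr rfl fun i _ => ?_
  simp; ring

lemma pair_zsmul (v : Fin 3 → ℚ) (n : ℤ) (x : Fin 3 → ℤ) : pair v (n • x) = n * pair v x := by
  simp only [pair, Finset.mul_sum]
  refine Finset.sum_congr rfl fun i _ => ?_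
  simp; ring

lemma single_mem {r a : ℕ} {τ : Set (Fin 3 → ℚ)} {m : Fin 3 → ℤ} (hm : m ∈ dualMonoid r a τ)
    (c : ℂ) : (AddMonoidAlgebra.single m c : Laurent) ∈ chartRing r a τ := by
  intro m' hm'
  have : m' = m := by
    by_contra h
    simp [Ne.symm h] at hm'
  rwa [this]

lemma chartRing_anti {r a : ℕ} {τ σ : Set (Fin 3 → ℚ)} (h : τ ⊆ σ) :
    chartRing r a σ ≤ chartRing r a τ :=
  fun _ hf m hm => ⟨(hf m hm).1, fun v hv => (hf m hm).2 v (h hv)⟩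

/-! ### The fan of the economic resolution -/

/-- The maximal cones of the fan obtained from a cone `⟨p, q, s⟩` of type `(1/r)(a, -a, 1)` by
repeated weighted blow-ups. If `0 < a < r`, the weighted blow-up of weight `(1/r)(a, r-a, 1)`, i.e.
the star subdivision at `w = (a p + (r-a) q + s) / r`, has the charts `⟨w, q, s⟩`, of type
`(1/a)(-r, r, 1)`, `⟨p, w, s⟩`, of type `(1/(r-a))(r, -r, 1)`, and the smooth chart `⟨p, q, w⟩`;
the first two are blown up further in the same way until they are smooth as well. -/
def maxCones (r a : ℕ) (p q s : Fin 3 → ℚ) : List ((Fin 3 → ℚ) × (Fin 3 → ℚ) × (Fin 3 → ℚ)) :=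
  if _h : 0 < a ∧ a < r then
    let w : Fin 3 → ℚ := (1 / (r : ℚ)) • ((a : ℚ) • p + ((r : ℚ) - a) • q + s)
    maxCones a ((-(r : ℤ)) % a).toNat w q s ++ maxCones (r - a) (r % (r - a)) p w s ++ [(p, q, w)]
  else [(p, q, s)]
termination_by r
decreasing_by all_goals omega

/-- The maximal cones of the economic resolution of `ℂ³ / (1/r)(a, -a, 1)`. -/
def fanMax (r a : ℕ) : List ((Fin 3 → ℚ) × (Fin 3 → ℚ) × (Fin 3 → ℚ)) :=
  maxCones r a (Pi.single 0 1) (Pi.single 1 1) (Pi.single 2 1)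

/-- The cones of the fan (each given by the set of its rays), ordered by inclusion. -/
def Fan (r a : ℕ) : Type :=
  {τ : Set (Fin 3 → ℚ) // ∃ c ∈ fanMax r a, τ ⊆ {c.1, c.2.1, c.2.2}}

instance (r a : ℕ) : PartialOrder (Fan r a) := inferInstanceAs (PartialOrder (Subtype _))

/-- The diagram of the affine toric charts `Spec ℂ[σ^∨ ∩ M]`. -/
def diagram (r a : ℕ) : Fan r a ⥤ Scheme.{0} where
  obj τ := Spec (CommRingCat.of (chartRing r a τ.1))
  map {τ σ} h := Spec.map (CommRingCat.ofHom
    (Subalgebra.inclusion (chartRing_anti (r := r) (a := a) (leOfHom h : τ.1 ⊆ σ.1))).toRingHom)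
  map_id τ := by
    rw [← Spec.map_id]; rfl
  map_comp f g := by
    rw [← Spec.map_comp]; rfl

/-- `IsCone r a r' a' p q s`: the lattice `M` is identified through `(p, q, s)` with the lattice of
exponents of the quotient `(1/r')(a', -a', 1)`. -/
structure IsCone (r a r' a' : ℕ) (p q s : Fin 3 → ℚ) : Prop where
  inj : ∀ m ∈ latticeM r a, pair p m = 0 → pair q m = 0 → pair s m = 0 → m = 0
  int : ∀ m ∈ latticeM r a, ∃ α β γ : ℤ, pair p m = α ∧ pair q m = β ∧ pair s m = γ ∧
    (r' : ℤ) ∣ a' * α - a' * β + γ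
  surj : ∀ α β γ : ℤ, (r' : ℤ) ∣ a' * α - a' * β + γ →
    ∃ m ∈ latticeM r a, pair p m = α ∧ pair q m = β ∧ pair s m = γ
  nonneg : 0 ≤ p ∧ 0 ≤ q ∧ 0 ≤ s

lemma pair_w (r' a' : ℕ) (p q s : Fin 3 → ℚ) (m : Fin 3 → ℤ) :
    pair ((1 / (r' : ℚ)) • ((a' : ℚ) • p + ((r' : ℚ) - a') • q + s)) m =
      (a' * pair p m + (r' - a') * pair q m + pair s m) / r' := by
  simp [pair, Fin.sum_univ_three]; ring

lemma isCone_start (r a : ℕ) :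
    IsCone r a r a (Pi.single 0 1) (Pi.single 1 1) (Pi.single 2 1) where
  inj m _ h0 h1 h2 := by
    simp [pair, Fin.sum_univ_three] at h0 h1 h2
    funext i; fin_cases i <;> simp [*]
  int m hm := by
    refine ⟨m 0, m 1, m 2, by simp [pair, Fin.sum_univ_three], by simp [pair, Fin.sum_univ_three],
      by simp [pair, Fin.sum_univ_three], ?_⟩
    have : (r : ℤ) ∣ ∑ i, weight a i * m i := hm
    simp only [Fin.sum_univ_three, weight, Matrix.cons_val] at this
    convert! this using 1; ring
  surj α β γ h := by
    refine ⟨![α, β, γ], ?_, by simp [pair, Fin.sum_univ_three], by simp [pair, Fin.sum_univ_three],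
      by simp [pair, Fin.sum_univ_three]⟩
    change (r : ℤ) ∣ ∑ i, weight a i * _
    simp only [Fin.sum_univ_three, weight, Matrix.cons_val]
    convert! h using 1; ring
  nonneg := ⟨by simp, by simp, by simp⟩

section step
variable {r a r' a' : ℕ} {p q s : Fin 3 → ℚ}

lemma w_nonneg (h : IsCone r a r' a' p q s) (h1 : a' < r') :
    0 ≤ (1 / (r' : ℚ)) • ((a' : ℚ) • p + ((r' : ℚ) - a') • q + s) := by
  obtain ⟨hp, hq, hs⟩ := h.nonneg
  have : (0 : ℚ) ≤ r' - a' := by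
    have : (a' : ℚ) ≤ r' := by exact_mod_cast h1.le
    linarith
  exact smul_nonneg (by positivity)
    (add_nonneg (add_nonneg (smul_nonneg (by positivity) hp) (smul_nonneg this hq)) hs)

lemma IsCone.left (h : IsCone r a r' a' p q s) (h0 : 0 < a') (h1 : a' < r') :
    IsCone r a a' ((-(r' : ℤ)) % a').toNat
      ((1 / (r' : ℚ)) • ((a' : ℚ) • p + ((r' : ℚ) - a') • q + s)) q s := by
  have hr : (r' : ℚ) ≠ 0 := by have : r' ≠ 0 := by omega
                               exact_mod_cast this
  have ha : (a' : ℚ) ≠ 0 := by exact_mod_cast h0.ne'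
  have hmod : (((-(r' : ℤ)) % a').toNat : ℤ) = -(r' : ℤ) - a' * (-(r' : ℤ) / a') := by
    rw [Int.toNat_of_nonneg (Int.emod_nonneg _ (by exact_mod_cast h0.ne')), Int.emod_def]
  refine ⟨fun m hm hw hq hs => ?_, fun m hm => ?_, fun ω β γ hd => ?_, w_nonneg h h1, h.nonneg.2⟩
  · refine h.inj m hm ?_ hq hs
    rw [pair_w, hq, hs] at hw
    field_simp at hw
    simpa [ha] using hw
  · obtain ⟨α, β, γ, hα, hβ, hγ, k, hk⟩ := h.int m hm
    have hkq : (a' : ℚ) * α - a' * β + γ = r' * k := by exact_mod_cast hk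
    refine ⟨k + β, β, γ, ?_, hβ, hγ, ?_⟩
    · rw [pair_w, hα, hβ, hγ, div_eq_iff hr]; push_cast; linear_combination hkq
    · rw [hmod]
      refine ⟨-α + β - (-(r' : ℤ) / a') * k, ?_⟩
      linear_combination hk
  · rw [hmod] at hd
    obtain ⟨k, hk⟩ := hd
    obtain ⟨m, hm, hα, hβ, hγ⟩ := h.surj (β - k - (-(r' : ℤ) / a') * (ω - β)) β γ
      ⟨ω - β, by linear_combination hk⟩
    refine ⟨m, hm, ?_, hβ, hγ⟩
    have hkq : ((-(r' : ℚ) - a' * ((-(r' : ℤ) / a' : ℤ) : ℚ)) * ω -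
      (-(r' : ℚ) - a' * ((-(r' : ℤ) / a' : ℤ) : ℚ)) * β + γ) = a' * k := by exact_mod_cast hk
    rw [pair_w, hα, hβ, hγ, div_eq_iff hr]
    push_cast
    linear_combination hkq

lemma IsCone.right (h : IsCone r a r' a' p q s) (h0 : 0 < a') (h1 : a' < r') :
    IsCone r a (r' - a') (r' % (r' - a')) p
      ((1 / (r' : ℚ)) • ((a' : ℚ) • p + ((r' : ℚ) - a') • q + s)) s := by
  have hr : (r' : ℚ) ≠ 0 := by have : r' ≠ 0 := by omega
                               exact_mod_cast this
  have hb : (r' : ℚ) - a' ≠ 0 := by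
    have : (a' : ℚ) < r' := by exact_mod_cast h1
    linarith
  obtain ⟨d, hmod⟩ : ∃ d : ℤ, ((r' % (r' - a') : ℕ) : ℤ) = r' - ((r' : ℤ) - a') * d := by
    refine ⟨((r' / (r' - a') : ℕ) : ℤ), ?_⟩
    have := Nat.div_add_mod r' (r' - a')
    zify [h1.le] at this ⊢
    linarith
  refine ⟨fun m hm hp hw hs => ?_, fun m hm => ?_, fun α ω γ hd => ?_, h.nonneg.1, w_nonneg h h1,
    h.nonneg.2.2⟩
  · refine h.inj m hm hp ?_ hs
    rw [pair_w, hp, hs] at hw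
    field_simp at hw
    simpa [hb] using hw
  · obtain ⟨α, β, γ, hα, hβ, hγ, k, hk⟩ := h.int m hm
    have hkq : (a' : ℚ) * α - a' * β + γ = r' * k := by exact_mod_cast hk
    refine ⟨α, k + β, γ, hα, ?_, hγ, ?_⟩
    · rw [pair_w, hα, hβ, hγ, div_eq_iff hr]; push_cast; linear_combination hkq
    · rw [hmod, Nat.cast_sub h1.le]
      refine ⟨α - β - d * (α - k - β), ?_⟩
      linear_combination hk
  · rw [hmod, Nat.cast_sub h1.le] at hd
    obtain ⟨k, hk⟩ := hd
    obtain ⟨m, hm, hα, hβ, hγ⟩ := h.surj α (α - k - d * (α - ω)) γ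
      ⟨ω - (α - k - d * (α - ω)), by linear_combination hk⟩
    refine ⟨m, hm, hα, ?_, hγ⟩
    have hkq : ((r' : ℚ) - (r' - a') * d) * α -
      (r' - (r' - a') * d) * ω + γ = (r' - a') * k := by
      have := congrArg (Int.cast : ℤ → ℚ) hk
      push_cast at this
      exact this
    rw [pair_w, hα, hβ, hγ, div_eq_iff hr]
    push_cast
    linear_combination hkq

lemma IsCone.top (h : IsCone r a r' a' p q s) (h1 : a' < r') :
    IsCone r a 1 0 p q ((1 / (r' : ℚ)) • ((a' : ℚ) • p + ((r' : ℚ) - a') • q + s)) := by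
  have hr : (r' : ℚ) ≠ 0 := by have : r' ≠ 0 := by omega
                               exact_mod_cast this
  refine ⟨fun m hm hp hq hw => ?_, fun m hm => ?_, fun α β ω _ => ?_, h.nonneg.1, h.nonneg.2.1,
    w_nonneg h h1⟩
  · refine h.inj m hm hp hq ?_
    rw [pair_w, hp, hq] at hw
    field_simp at hw
    simpa using hw
  · obtain ⟨α, β, γ, hα, hβ, hγ, k, hk⟩ := h.int m hm
    have hkq : (a' : ℚ) * α - a' * β + γ = r' * k := by exact_mod_cast hk
    refine ⟨α, β, k + β, hα, hβ, ?_, by simp⟩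
    rw [pair_w, hα, hβ, hγ, div_eq_iff hr]; push_cast; linear_combination hkq
  · obtain ⟨m, hm, hα, hβ, hγ⟩ := h.surj α β (r' * (ω - β) - a' * α + a' * β) ⟨ω - β, by ring⟩
    refine ⟨m, hm, hα, hβ, ?_⟩
    rw [pair_w, hα, hβ, hγ, div_eq_iff hr]; push_cast; ring

end step

/-- All maximal cones of the fan are smooth. -/
lemma isCone_of_mem {r a : ℕ} (r' a' : ℕ) (p q s : Fin 3 → ℚ) (hcop : Nat.Coprime a' r')
    (hlt : a' < r') (h : IsCone r a r' a' p q s)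
    {c : (Fin 3 → ℚ) × (Fin 3 → ℚ) × (Fin 3 → ℚ)} (hc : c ∈ maxCones r' a' p q s) :
    IsCone r a 1 0 c.1 c.2.1 c.2.2 := by
  induction r' using Nat.strong_induction_on generalizing a' p q s with
  | _ r' ih =>
  rw [maxCones] at hc
  split_ifs at hc with h01
  · obtain ⟨h0, h1⟩ := h01
    simp only [List.mem_append, List.mem_singleton] at hc
    rcases hc with (hc | hc) | hc
    · refine ih a' h1 _ _ _ _ ?_ ?_ (h.left h0 h1) hc
      · have h2 := Int.toNat_of_nonneg (Int.emod_nonneg (-(r' : ℤ)) (b := a') (by omega))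
        rw [← Nat.isCoprime_iff_coprime, h2, Int.emod_def]
        obtain ⟨u, v, e⟩ := Nat.isCoprime_iff_coprime.2 hcop
        exact ⟨-v, u - v * (-(r' : ℤ) / a'), by linear_combination e⟩
      · have := Int.emod_lt_of_pos (-(r' : ℤ)) (b := a') (by omega)
        have h2 := Int.emod_nonneg (-(r' : ℤ)) (b := a') (by omega)
        omega
    · refine ih (r' - a') (by omega) _ _ _ _ ?_ (Nat.mod_lt _ (by omega)) (h.right h0 h1) hc
      unfold Nat.Coprime
      rw [← Nat.gcd_rec]
      have h3 := (Nat.coprime_sub_self_left h1.le).2 (Nat.Coprime.symm hcop)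
      have : Nat.Coprime (r' - a') r' := by
        have h4 : r' = (r' - a') + a' := by omega
        rw [h4]; simpa using h3
      exact this
    · rw [hc]; exact h.top h1
  · have ha : a' = 0 := by omega
    subst ha
    have : r' = 1 := by simpa using hcop
    subst this
    simp only [List.mem_singleton] at hc
    rw [hc]; exact h

lemma isCone_fan {r a : ℕ} [IsTerminalType r a] {c : (Fin 3 → ℚ) × (Fin 3 → ℚ) × (Fin 3 → ℚ)}
    (hc : c ∈ fanMax r a) : IsCone r a 1 0 c.1 c.2.1 c.2.2 :=
  isCone_of_mem r a _ _ _ IsTerminalType.coprime IsTerminalType.lt (isCone_start r a) hc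

/-! ### Gluing the charts -/

lemma exists_face {r a : ℕ} [IsTerminalType r a] {τ σ : Fan r a} (_h : τ ≤ σ) :
    ∃ m ∈ latticeM r a, (∀ v ∈ τ.1, pair v m = 0) ∧ (∀ v ∈ σ.1, v ∉ τ.1 → 1 ≤ pair v m) := by
  classical
  obtain ⟨c, hc, hσ⟩ := σ.2
  obtain ⟨m, hm, h1, h2, h3⟩ := (isCone_fan hc).surj (if c.1 ∈ τ.1 then 0 else 1)
    (if c.2.1 ∈ τ.1 then 0 else 1) (if c.2.2 ∈ τ.1 then 0 else 1) (by simp)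
  refine ⟨m, hm, fun v hv => ?_, fun v hv hv' => ?_⟩
  · rcases hσ (_h hv) with rfl | rfl | rfl
    · simpa [hv] using h1
    · simpa [hv] using h2
    · simpa [hv] using h3
  · rcases hσ hv with rfl | rfl | rfl
    · simp [h1, hv']
    · simp [h2, hv']
    · simp [h3, hv']

/-- Passing to a face is the localization at a monomial. -/
lemma isLocalization_face {r a : ℕ} {τ σ : Set (Fin 3 → ℚ)} (hτσ : τ ⊆ σ) {m : Fin 3 → ℤ}
    (hm : m ∈ latticeM r a) (h0 : ∀ v ∈ τ, pair v m = 0) (h1 : ∀ v ∈ σ, v ∉ τ → 1 ≤ pair v m)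
    (hmσ : m ∈ dualMonoid r a σ) (hfin : σ.Finite) :
    letI := (Subalgebra.inclusion (chartRing_anti (r := r) (a := a) hτσ)).toRingHom.toAlgebra
    IsLocalization.Away (⟨AddMonoidAlgebra.single m 1, single_mem hmσ 1⟩ : chartRing r a σ)
      (chartRing r a τ) := by
  let _ := (Subalgebra.inclusion (chartRing_anti (r := r) (a := a) hτσ)).toRingHom.toAlgebra
  have hneg : -m ∈ dualMonoid r a τ :=
    ⟨neg_mem hm, fun v hv => by rw [pair_neg, h0 v hv]; simp⟩
  refine IsLocalization.Away.mk _ ?_ ?_ ?_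
  · refine IsUnit.of_mul_eq_one ⟨AddMonoidAlgebra.single (-m) 1, single_mem hneg 1⟩ ?_
    apply Subtype.ext
    change (AddMonoidAlgebra.single m 1 * AddMonoidAlgebra.single (-m) 1 : Laurent) = 1
    rw [AddMonoidAlgebra.single_mul_single]
    simp [AddMonoidAlgebra.one_def]
  · intro f
    obtain ⟨n, hn⟩ : ∃ n : ℕ, ∀ v ∈ σ, v ∉ τ → ∀ k ∈ f.1.coeff.support, 0 ≤ pair v k + n := by
      obtain ⟨n, hn⟩ := exists_nat_ge
        (∑ v ∈ hfin.toFinset, ∑ k ∈ f.1.coeff.support, |pair v k|)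
      refine ⟨n, fun v hv _ k hk => ?_⟩
      have h2 : |pair v k| ≤ ∑ k ∈ f.1.coeff.support, |pair v k| :=
        Finset.single_le_sum (f := fun k => |pair v k|) (fun _ _ => abs_nonneg _) hk
      have h3 : ∑ k ∈ f.1.coeff.support, |pair v k| ≤
          ∑ v ∈ hfin.toFinset, ∑ k ∈ f.1.coeff.support, |pair v k| :=
        Finset.single_le_sum (f := fun v => ∑ k ∈ f.1.coeff.support, |pair v k|)
          (fun _ _ => Finset.sum_nonneg fun _ _ => abs_nonneg _) (hfin.mem_toFinset.2 hv)
      have := neg_abs_le (pair v k)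
      linarith
    have hmem : (f.1 * AddMonoidAlgebra.single (n • m) 1 : Laurent) ∈ chartRing r a σ := by
      intro k hk
      classical
      obtain ⟨x, hx, y, hy, rfl⟩ :=
        Finset.mem_add.1 (AddMonoidAlgebra.support_coeff_mul_subset _ _ hk)
      have hy' : y = n • m := by
        by_contra h
        rw [AddMonoidAlgebra.coeff_single, Finsupp.mem_support_iff, Finsupp.single_apply,
          if_neg (Ne.symm h)] at hy
        exact hy rfl
      subst hy'
      refine ⟨add_mem (f.2 x hx).1 (nsmul_mem hm n), fun v hv => ?_⟩
      rw [pair_add, pair_nsmul]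
      by_cases hvτ : v ∈ τ
      · rw [h0 v hvτ]; simpa using (f.2 x hx).2 v hvτ
      · have := hn v hv hvτ x hx
        have h5 : (n : ℚ) * 1 ≤ n * pair v m :=
          mul_le_mul_of_nonneg_left (h1 v hv hvτ) (by positivity)
        linarith
    refine ⟨n, ⟨_, hmem⟩, ?_⟩
    apply Subtype.ext
    change (f.1 * AddMonoidAlgebra.single m 1 ^ n : Laurent) = f.1 * _
    rw [AddMonoidAlgebra.single_pow]; simp
  · intro x y hxy
    refine ⟨0, ?_⟩
    have : x.1 = y.1 := congrArg (fun g : chartRing r a τ => g.1) hxy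
    rw [Subtype.ext this]

lemma Fan.finite {r a : ℕ} (τ : Fan r a) : τ.1.Finite := by
  obtain ⟨c, -, h⟩ := τ.2
  exact Set.Finite.subset (by simp) h

lemma face_mem {r a : ℕ} {τ σ : Set (Fin 3 → ℚ)} {m : Fin 3 → ℤ}
    (hm : m ∈ latticeM r a) (h0 : ∀ v ∈ τ, pair v m = 0) (h1 : ∀ v ∈ σ, v ∉ τ → 1 ≤ pair v m) :
    m ∈ dualMonoid r a σ :=
  ⟨hm, fun v hv => by
    by_cases h : v ∈ τ
    · rw [h0 v h]
    · linarith [h1 v hv h]⟩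

instance diagram_isOpenImmersion (r a : ℕ) [IsTerminalType r a] {τ σ : Fan r a} (h : τ ⟶ σ) :
    IsOpenImmersion ((diagram r a).map h) := by
  obtain ⟨m, hm, h0, h1⟩ := exists_face (leOfHom h)
  let _ := (Subalgebra.inclusion
    (chartRing_anti (r := r) (a := a) (leOfHom h : τ.1 ⊆ σ.1))).toRingHom.toAlgebra
  have := isLocalization_face (leOfHom h : τ.1 ⊆ σ.1) hm h0 h1 (face_mem hm h0 h1) σ.finite
  exact IsOpenImmersion.of_isLocalization
    (⟨AddMonoidAlgebra.single m 1, single_mem (face_mem hm h0 h1) 1⟩ : chartRing r a σ.1)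

lemma range_diagram_map {r a : ℕ} {τ σ : Fan r a} (h : τ ⟶ σ)
    {m : Fin 3 → ℤ} (hm : m ∈ latticeM r a) (h0 : ∀ v ∈ τ.1, pair v m = 0)
    (h1 : ∀ v ∈ σ.1, v ∉ τ.1 → 1 ≤ pair v m) :
    Set.range ((diagram r a).map h) = (PrimeSpectrum.basicOpen
      (⟨AddMonoidAlgebra.single m 1, single_mem (face_mem hm h0 h1) 1⟩ : chartRing r a σ.1) :
        Set (PrimeSpectrum (chartRing r a σ.1))) := by
  let _ := (Subalgebra.inclusion
    (chartRing_anti (r := r) (a := a) (leOfHom h : τ.1 ⊆ σ.1))).toRingHom.toAlgebra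
  have := isLocalization_face (leOfHom h : τ.1 ⊆ σ.1) hm h0 h1 (face_mem hm h0 h1) σ.finite
  exact PrimeSpectrum.localization_away_comap_range (chartRing r a τ.1)
    (⟨AddMonoidAlgebra.single m 1, single_mem (face_mem hm h0 h1) 1⟩ : chartRing r a σ.1)

instance diagram_isLocallyDirected (r a : ℕ) [IsTerminalType r a] :
    (diagram r a ⋙ Scheme.forget).IsLocallyDirected where
  cond {i j k} fi fj xi xj hx := by
    change (diagram r a).map fi xi = (diagram r a).map fj xj at hx
    obtain ⟨m, hm, h0, h1⟩ := exists_face (leOfHom fi)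
    obtain ⟨n, hn, h0', h1'⟩ := exists_face (leOfHom fj)
    let l : Fan r a := ⟨i.1 ∩ j.1, by
      obtain ⟨c, hc, h⟩ := i.2
      exact ⟨c, hc, Set.inter_subset_left.trans h⟩⟩
    have hi : l ≤ i := Set.inter_subset_left
    have hj : l ≤ j := Set.inter_subset_right
    have hmn : m + n ∈ latticeM r a := add_mem hm hn
    have hik : i.1 ⊆ k.1 := leOfHom fi
    have hjk : j.1 ⊆ k.1 := leOfHom fj
    have g0 : ∀ v ∈ l.1, pair v (m + n) = 0 := fun v hv => by
      rw [pair_add, h0 v hv.1, h0' v hv.2, add_zero]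
    have g1 : ∀ v ∈ k.1, v ∉ l.1 → 1 ≤ pair v (m + n) := fun v hv hv' => by
      rw [pair_add]
      by_cases a1 : v ∈ i.1
      · rw [h0 v a1]
        linarith [h1' v hv fun h => hv' ⟨a1, h⟩]
      · have := h1 v hv a1
        have := (face_mem hn h0' h1').2 v hv
        linarith
    have e1 : (diagram r a).map fi xi ∈ Set.range ((diagram r a).map fi) := ⟨xi, rfl⟩
    have e2 : (diagram r a).map fi xi ∈ Set.range ((diagram r a).map fj) := ⟨xj, hx.symm⟩
    have e3 : (diagram r a).map fi xi ∈
        Set.range ((diagram r a).map (homOfLE (hi.trans (leOfHom fi)))) := by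
      rw [range_diagram_map fi hm h0 h1] at e1
      rw [range_diagram_map fj hn h0' h1'] at e2
      rw [range_diagram_map _ hmn g0 g1]
      have : (⟨AddMonoidAlgebra.single (m + n) 1, single_mem (face_mem hmn g0 g1) 1⟩ :
          chartRing r a k.1) = ⟨AddMonoidAlgebra.single m 1, single_mem (face_mem hm h0 h1) 1⟩ *
            ⟨AddMonoidAlgebra.single n 1, single_mem (face_mem hn h0' h1') 1⟩ := by
        apply Subtype.ext
        change _ = (AddMonoidAlgebra.single m 1 * AddMonoidAlgebra.single n 1 : Laurent)
        rw [AddMonoidAlgebra.single_mul_single]; simp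
      rw [this, PrimeSpectrum.basicOpen_mul]
      exact ⟨e1, e2⟩
    obtain ⟨x, hx'⟩ := e3
    refine ⟨l, homOfLE hi, homOfLE hj, x, ?_, ?_⟩
    · apply ((diagram r a).map fi).isOpenEmbedding.injective
      change ((diagram r a).map fi) (((diagram r a).map (homOfLE hi)) x) = _
      rw [← Scheme.Hom.comp_apply, ← Functor.map_comp]
      exact hx'
    · apply ((diagram r a).map fj).isOpenEmbedding.injective
      change ((diagram r a).map fj) (((diagram r a).map (homOfLE hj)) x) = (diagram r a).map fj xj
      rw [← Scheme.Hom.comp_apply, ← Functor.map_comp, ← hx]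
      exact hx'

/-- The economic resolution `Y` of `ℂ³ / (1/r)(a, -a, 1)`: the toric variety of the fan obtained by
repeated weighted blow-ups, glued from its affine charts along their common faces. -/
def economicResolution (r a : ℕ) [IsTerminalType r a] : Scheme.{0} := colimit (diagram r a)

/-- The inclusion of a chart. -/
def chartι (r a : ℕ) [IsTerminalType r a] (τ : Fan r a) :
    Spec (CommRingCat.of (chartRing r a τ.1)) ⟶ economicResolution r a := colimit.ι (diagram r a) τ

instance (r a : ℕ) [IsTerminalType r a] (τ : Fan r a) : IsOpenImmersion (chartι r a τ) :=
  inferInstanceAs (IsOpenImmersion (colimit.ι (diagram r a) τ))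

lemma chartι_surj (r a : ℕ) [IsTerminalType r a] (y : economicResolution r a) :
    ∃ τ x, chartι r a τ x = y :=
  Scheme.IsLocallyDirected.ι_jointly_surjective (diagram r a) y

lemma fanMax_ne_nil (r a : ℕ) : ∃ c, c ∈ fanMax r a := by
  unfold fanMax
  rw [maxCones]
  split_ifs with h
  · exact ⟨_, by simp; exact Or.inr (Or.inr rfl)⟩
  · exact ⟨_, List.mem_singleton.2 rfl⟩

/-- The cone `0`, whose chart is the torus. -/
def Fan.zero (r a : ℕ) : Fan r a :=
  ⟨∅, (fanMax_ne_nil r a).choose, (fanMax_ne_nil r a).choose_spec, Set.empty_subset _⟩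

instance (r a : ℕ) [IsTerminalType r a] : IsIntegral (economicResolution r a) := by
  have hne : ∀ τ : Fan r a, Nonempty (Spec (CommRingCat.of (chartRing r a τ.1))) := fun τ =>
    inferInstanceAs (Nonempty (PrimeSpectrum (chartRing r a τ.1)))
  have hred : IsReduced (economicResolution r a) := by
    have : ∀ i, IsReduced ((Scheme.IsLocallyDirected.openCover (diagram r a)).X i) := fun i =>
      inferInstanceAs (IsReduced (Spec (CommRingCat.of (chartRing r a i.1))))
    exact IsReduced.of_openCover _ (Scheme.IsLocallyDirected.openCover (diagram r a))
  -- the image of the torus is irreducible and dense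
  have hdense : Dense (Set.range (chartι r a (Fan.zero r a))) := by
    intro y
    obtain ⟨τ, x, rfl⟩ := chartι_surj r a y
    have hle : Fan.zero r a ≤ τ := Set.empty_subset _
    have hd : Dense (Set.range ((diagram r a).map (homOfLE hle))) := by
      have ho := ((diagram r a).map (homOfLE hle)).isOpenEmbedding.isOpen_range
      have : IrreducibleSpace ((diagram r a).obj τ) :=
        inferInstanceAs (IrreducibleSpace (Spec (CommRingCat.of (chartRing r a τ.1))))
      have hn := hne (Fan.zero r a)
      exact ho.dense (@Set.range_nonempty _ _ hn _)
    have hx := hd x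
    have h1 := image_closure_subset_closure_image (chartι r a τ).continuous ⟨x, hx, rfl⟩
    refine closure_mono ?_ h1
    rintro _ ⟨_, ⟨z, rfl⟩, rfl⟩
    refine ⟨z, ?_⟩
    have : (diagram r a).map (homOfLE hle) ≫ chartι r a τ = chartι r a (Fan.zero r a) :=
      colimit.w (diagram r a) (homOfLE hle)
    exact (congrArg (fun g => g.base z) this).symm
  have hirr : IrreducibleSpace (economicResolution r a) := by
    have h1 : IsIrreducible (Set.range (chartι r a (Fan.zero r a))) := by
      rw [← Set.image_univ]
      exact (IrreducibleSpace.isIrreducible_univ _).image _ (chartι r a _).continuous.continuousOn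
    have h2 := h1.closure
    rw [hdense.closure_eq] at h2
    exact (irreducibleSpace_def _).2 h2
  exact isIntegral_of_irreducibleSpace_of_isReduced _

lemma chartRing_fg (r a : ℕ) [IsTerminalType r a] (τ : Fan r a) : (chartRing r a τ.1).FG := by
  classical
  obtain ⟨c, hc, hτ⟩ := τ.2
  have hC := isCone_fan hc
  obtain ⟨mp, hmp, p1, p2, p3⟩ := hC.surj 1 0 0 (by simp)
  obtain ⟨mq, hmq, q1, q2, q3⟩ := hC.surj 0 1 0 (by simp)
  obtain ⟨ms, hms, s1, s2, s3⟩ := hC.surj 0 0 1 (by simp)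
  let gen : Finset (Fin 3 → ℤ) := {mp, mq, ms, -mp, -mq, -ms}
  let G : Finset Laurent :=
    (gen.filter (· ∈ dualMonoid r a τ.1)).image fun m => AddMonoidAlgebra.single m 1
  refine ⟨G, le_antisymm ?_ ?_⟩
  · rw [Algebra.adjoin_le_iff]
    intro g hg
    obtain ⟨m, hm, rfl⟩ := Finset.mem_image.1 (Finset.mem_coe.1 hg)
    exact single_mem (Finset.mem_filter.1 hm).2 1
  · intro f hf
    have key : ∀ m ∈ dualMonoid r a τ.1,
        (AddMonoidAlgebra.single m 1 : Laurent) ∈ Algebra.adjoin ℂ (G : Set Laurent) := by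
      intro m hm
      obtain ⟨α, β, γ, hα, hβ, hγ, -⟩ := hC.int m hm.1
      have hmem : ∀ n ∈ gen, n ∈ dualMonoid r a τ.1 → ∀ k : ℕ,
          (AddMonoidAlgebra.single (k • n) 1 : Laurent) ∈ Algebra.adjoin ℂ (G : Set Laurent) := by
        intro n hn hn' k
        have h1 : (AddMonoidAlgebra.single n 1 : Laurent) ∈ Algebra.adjoin ℂ (G : Set Laurent) :=
          Algebra.subset_adjoin (Finset.mem_coe.2
            (Finset.mem_image.2 ⟨n, Finset.mem_filter.2 ⟨hn, hn'⟩, rfl⟩))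
        have := pow_mem h1 k
        rwa [AddMonoidAlgebra.single_pow, one_pow] at this
      have hz : ∀ (v : Fin 3 → ℚ) (n : Fin 3 → ℤ) (k : ℤ), n ∈ gen → -n ∈ gen →
          n ∈ latticeM r a → pair v n = 1 → pair v m = k →
          (∀ u ∈ τ.1, u ≠ v → pair u n = 0) →
          (AddMonoidAlgebra.single (k • n) 1 : Laurent) ∈
            Algebra.adjoin ℂ (G : Set Laurent) := by
        intro v n k hn hn' hnM hv hk hu
        have hpos : n ∈ dualMonoid r a τ.1 := ⟨hnM, fun u huτ => by
          by_cases h : u = v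
          · rw [h, hv]; norm_num
          · rw [hu u huτ h]⟩
        rcases le_or_gt 0 k with h | h
        · have := hmem n hn hpos k.toNat
          rwa [← natCast_zsmul, Int.toNat_of_nonneg h] at this
        · have hvτ : v ∉ τ.1 := fun hvτ => by
            have := hm.2 v hvτ
            rw [hk] at this
            have : 0 ≤ k := by exact_mod_cast this
            omega
          have hneg : -n ∈ dualMonoid r a τ.1 := ⟨neg_mem hnM, fun u huτ => by
            have h : u ≠ v := fun h => hvτ (h ▸ huτ)
            rw [pair_neg, hu u huτ h]; simp⟩
          have := hmem (-n) hn' hneg (-k).toNat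
          rw [← natCast_zsmul, Int.toNat_of_nonneg (by omega)] at this
          simpa using this
      have hsum : m = α • mp + β • mq + γ • ms := by
        have : m - (α • mp + β • mq + γ • ms) = 0 := by
          have hM : m - (α • mp + β • mq + γ • ms) ∈ latticeM r a :=
            sub_mem hm.1 (add_mem (add_mem (zsmul_mem hmp _) (zsmul_mem hmq _)) (zsmul_mem hms _))
          refine hC.inj _ hM ?_ ?_ ?_ <;>
            rw [sub_eq_add_neg, pair_add, pair_neg, pair_add, pair_add, pair_zsmul, pair_zsmul,
              pair_zsmul]
          · rw [hα, p1, q1, s1]; push_cast; ring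
          · rw [hβ, p2, q2, s2]; push_cast; ring
          · rw [hγ, p3, q3, s3]; push_cast; ring
        exact sub_eq_zero.1 this
      have h1 := hz c.1 mp α (by simp [gen]) (by simp [gen]) hmp (by simpa using p1) hα
        (fun u hu hne => by
          rcases hτ hu with rfl | rfl | rfl
          · exact absurd rfl hne
          · simpa using p2
          · simpa using p3)
      have h2 := hz c.2.1 mq β (by simp [gen]) (by simp [gen]) hmq (by simpa using q2) hβ
        (fun u hu hne => by
          rcases hτ hu with rfl | rfl | rfl
          · simpa using q1
          · exact absurd rfl hne
          · simpa using q3)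
      have h3 := hz c.2.2 ms γ (by simp [gen]) (by simp [gen]) hms (by simpa using s3) hγ
        (fun u hu hne => by
          rcases hτ hu with rfl | rfl | rfl
          · simpa using s1
          · simpa using s2
          · exact absurd rfl hne)
      have := mul_mem (mul_mem h1 h2) h3
      rw [AddMonoidAlgebra.single_mul_single, AddMonoidAlgebra.single_mul_single] at this
      rw [hsum]
      simpa using this
    have hdec : f = ∑ m ∈ f.coeff.support, f.coeff m • (AddMonoidAlgebra.single m 1 : Laurent) := by
      conv_lhs => rw [← AddMonoidAlgebra.sum_coeff_single f]
      rw [Finsupp.sum]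
      refine Finset.sum_congr rfl fun m _ => ?_
      simp
    rw [hdec]
    exact sum_mem fun m hm => Subalgebra.smul_mem _ (key m (hf m hm)) _

instance (r a : ℕ) [IsTerminalType r a] : IsLocallyNoetherian (economicResolution r a) := by
  rw [economicResolution,
    isLocallyNoetherian_iff_openCover (Scheme.IsLocallyDirected.openCover (diagram r a))]
  intro τ
  have : IsNoetherianRing (chartRing r a τ.1) := isNoetherianRing_of_fg (chartRing_fg r a τ)
  exact inferInstanceAs (IsLocallyNoetherian (Spec (CommRingCat.of (chartRing r a τ.1))))

/-! ### The morphism to `X` -/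

/-- The inclusion of the polynomials into the Laurent polynomials. -/
def toLaurent : MvPolynomial (Fin 3) ℂ →ₐ[ℂ] Laurent :=
  MvPolynomial.aeval fun i => AddMonoidAlgebra.single (Pi.single i 1) 1

lemma toLaurent_monomial (m : Fin 3 →₀ ℕ) (c : ℂ) :
    toLaurent (MvPolynomial.monomial m c) = AddMonoidAlgebra.single (fun i => (m i : ℤ)) c := by
  rw [toLaurent, MvPolynomial.aeval_monomial, Finsupp.prod_fintype _ _ (by simp)]
  simp only [Fin.prod_univ_three, AddMonoidAlgebra.single_pow, AddMonoidAlgebra.single_mul_single,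
    one_pow, mul_one, AddMonoidAlgebra.coe_algebraMap, Function.comp_apply, Algebra.algebraMap_self,
    RingHom.id_apply, zero_add]
  congr 1
  funext i
  fin_cases i <;> simp

lemma action_monomial (r a : ℕ) (m : Fin 3 →₀ ℕ) (c : ℂ) :
    action r a (MvPolynomial.monomial m c) = MvPolynomial.monomial m
      (Complex.exp (2 * Real.pi * Complex.I / r) ^ (∑ i, weight a i * m i) * c) := by
  rw [action, MvPolynomial.aeval_monomial, Finsupp.prod_fintype _ _ (by simp),
    MvPolynomial.monomial_eq, Finsupp.prod_fintype _ _ (by simp)]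
  simp only [mul_pow, Finset.prod_mul_distrib, ← map_pow, ← map_prod]
  rw [← mul_assoc, MvPolynomial.algebraMap_eq, ← map_mul]
  congr 2
  rw [mul_comm c]
  congr 1
  have h0 := Complex.exp_ne_zero (2 * Real.pi * Complex.I / r)
  simp only [Fin.sum_univ_three, Fin.prod_univ_three, zpow_add₀ h0, zpow_mul, zpow_natCast]

lemma coeff_action (r a : ℕ) (f : MvPolynomial (Fin 3) ℂ) (m : Fin 3 →₀ ℕ) :
    (action r a f).coeff m =
      Complex.exp (2 * Real.pi * Complex.I / r) ^ (∑ i, weight a i * m i) * f.coeff m := by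
  induction f using MvPolynomial.induction_on' with
  | monomial n c =>
    rw [action_monomial, MvPolynomial.coeff_monomial, MvPolynomial.coeff_monomial]
    split_ifs with h
    · rw [h]
    · simp
  | add p q hp hq => rw [map_add, MvPolynomial.coeff_add, MvPolynomial.coeff_add, hp, hq]; ring

lemma mem_invariants {r a : ℕ} [IsTerminalType r a] {f : MvPolynomial (Fin 3) ℂ} :
    f ∈ invariants r a ↔ ∀ m ∈ f.support, (r : ℤ) ∣ ∑ i, weight a i * m i := by
  have hr : r ≠ 0 := by
    have := IsTerminalType.lt (r := r) (a := a)
    omega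
  have hξ := Complex.isPrimitiveRoot_exp r hr
  change action r a f = f ↔ _
  rw [MvPolynomial.ext_iff]
  refine forall_congr' fun m => ?_
  rw [coeff_action, MvPolynomial.mem_support_iff, ← hξ.zpow_eq_one_iff_dvd]
  by_cases h : f.coeff m = 0
  · simp [h]
  · simp [h]

lemma nonneg_of_mem_fan {r a : ℕ} [IsTerminalType r a] (τ : Fan r a) {v : Fin 3 → ℚ}
    (hv : v ∈ τ.1) : 0 ≤ v := by
  obtain ⟨c, hc, hτ⟩ := τ.2
  obtain ⟨h1, h2, h3⟩ := (isCone_fan hc).nonneg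
  rcases hτ hv with rfl | rfl | rfl <;> assumption

lemma toLaurent_mem {r a : ℕ} [IsTerminalType r a] (τ : Fan r a) (f : invariants r a) :
    toLaurent f.1 ∈ chartRing r a τ.1 := by
  rw [f.1.as_sum, map_sum]
  refine sum_mem fun m hm => ?_
  rw [toLaurent_monomial]
  refine single_mem ⟨mem_invariants.1 f.2 m hm, fun v hv => ?_⟩ _
  exact Finset.sum_nonneg fun i _ => mul_nonneg (nonneg_of_mem_fan τ hv i) (by positivity)

/-- The inclusion of the invariant polynomials into a chart ring. -/
def toChart (r a : ℕ) [IsTerminalType r a] (τ : Fan r a) : invariants r a →ₐ[ℂ] chartRing r a τ.1 :=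
  (toLaurent.comp (invariants r a).val).codRestrict _ (toLaurent_mem τ)

/-- The resolution morphism `Y ⟶ X`, given on each chart by the inclusion of coordinate rings. -/
def resolution (r a : ℕ) [IsTerminalType r a] : economicResolution r a ⟶ quotient r a :=
  colimit.desc (diagram r a)
    { pt := quotient r a
      ι :=
        { app := fun τ => Spec.map (CommRingCat.ofHom (toChart r a τ).toRingHom)
          naturality := fun τ σ h => by
            change Spec.map _ ≫ Spec.map _ = Spec.map _ ≫ 𝟙 _
            rw [← Spec.map_comp, Category.comp_id]; rfl } }

instance (r a : ℕ) [IsTerminalType r a] : IsNoetherianRing (invariants r a) := by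
  have hr : r ≠ 0 := by
    have := IsTerminalType.lt (r := r) (a := a)
    omega
  have hX : ∀ i : Fin 3, (MvPolynomial.X i ^ r : MvPolynomial (Fin 3) ℂ) ∈ invariants r a := by
    intro i
    rw [mem_invariants]
    intro m hm
    rw [MvPolynomial.X_pow_eq_monomial, MvPolynomial.support_monomial, if_neg one_ne_zero,
      Finset.mem_singleton] at hm
    subst hm
    refine Finset.dvd_sum fun j _ => ?_
    by_cases h : i = j
    · subst h; simp
    · simp [h]
  have hint : Algebra.IsIntegral (invariants r a) (MvPolynomial (Fin 3) ℂ) := by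
    constructor
    intro f
    induction f using MvPolynomial.induction_on with
    | C c => exact isIntegral_algebraMap (x := algebraMap ℂ (invariants r a) c)
    | add p q hp hq => exact hp.add hq
    | mul_X p i hp =>
      refine hp.mul (IsIntegral.of_pow (Nat.pos_of_ne_zero hr) ?_)
      exact isIntegral_algebraMap (x := (⟨_, hX i⟩ : invariants r a))
  have hft : Algebra.FiniteType (invariants r a) (MvPolynomial (Fin 3) ℂ) :=
    Algebra.FiniteType.of_restrictScalars_finiteType ℂ _ _
  have hfin : Module.Finite (invariants r a) (MvPolynomial (Fin 3) ℂ) :=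
    Algebra.IsIntegral.finite
  have := fg_of_fg_of_fg ℂ (invariants r a) (MvPolynomial (Fin 3) ℂ)
    (Algebra.FiniteType.out) hfin.fg_top Subtype.val_injective
  have : Algebra.FiniteType ℂ (invariants r a) := ⟨this⟩
  exact Algebra.FiniteType.isNoetherianRing ℂ _

instance (r a : ℕ) [IsTerminalType r a] : IsLocallyNoetherian (quotient r a) :=
  inferInstanceAs (IsLocallyNoetherian (Spec (CommRingCat.of (invariants r a))))

instance (r a : ℕ) : IsIntegral (quotient r a) :=
  inferInstanceAs (IsIntegral (Spec (CommRingCat.of (invariants r a))))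

/-! ### Exceptional divisors and discrepancies -/

/-- A prime divisor of `Y`, given by its generic point `y`, is exceptional for `f : Y ⟶ X` if its
image has codimension at least two. -/
def IsExceptionalDivisor {X Y : Scheme.{0}} (f : Y ⟶ X) (y : Y) : Prop :=
  Order.coheight y = 1 ∧ 1 < Order.coheight (f y)

/-- The form `db₀ ∧ db₁ ∧ db₂`. -/
def wedge {K : Type} [Field K] [Algebra ℂ K] (b : Fin 3 → K) : ⋀[K]^3 Ω[K⁄ℂ] :=
  exteriorPower.ιMulti K 3 fun i => KaehlerDifferential.D ℂ K (b i)

/-- The complex numbers inside the function field of a scheme over `ℂ`. -/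
def scalars {Z : Scheme.{0}} [IsIntegral Z] (π : Z ⟶ Spec (CommRingCat.of ℂ)) :
    ℂ →+* Z.functionField :=
  (Z.presheaf.germ ⊤ (genericPoint Z) trivial).hom.comp
    (π.appTop.hom.comp (Scheme.ΓSpecIso (CommRingCat.of ℂ)).inv.hom)

/-- The rational three-form `db₀ ∧ db₁ ∧ db₂` is nonzero and has order `n` along the prime divisor
with generic point `z`: it is `u • (dt₀ ∧ dt₁ ∧ dt₂)`, where `u` has order `n` at `z` and
`t₀, t₁, t₂` are elements of the local ring at `z` such that `dt₀ ∧ dt₁ ∧ dt₂` generates the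
three-forms of that local ring. -/
def HasFormOrder {Z : Scheme.{0}} [IsIntegral Z] [IsLocallyNoetherian Z]
    (π : Z ⟶ Spec (CommRingCat.of ℂ)) (b : Fin 3 → Z.functionField) (z : Z) (n : ℤ) : Prop :=
  letI : Algebra ℂ Z.functionField := (scalars π).toAlgebra
  ∃ t : Fin 3 → Z.presheaf.stalk z,
    (∀ c : Fin 3 → Z.presheaf.stalk z, ∃ e : Z.presheaf.stalk z,
      wedge (fun i => algebraMap (Z.presheaf.stalk z) Z.functionField (c i)) =
        algebraMap (Z.presheaf.stalk z) Z.functionField e •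
          wedge fun i => algebraMap (Z.presheaf.stalk z) Z.functionField (t i)) ∧
    ∃ u : Z.functionField,
      wedge b = u • wedge (fun i => algebraMap (Z.presheaf.stalk z) Z.functionField (t i)) ∧
      wedge b ≠ 0 ∧ Scheme.ord u z = n

/-- The rational section `h (db₀ ∧ db₁ ∧ db₂)^{⊗ m}` of the `m`-th power of the canonical sheaf is
nonzero and has order `n` along the prime divisor with generic point `z`. -/
def HasPluriformOrder {Z : Scheme.{0}} [IsIntegral Z] [IsLocallyNoetherian Z]
    (π : Z ⟶ Spec (CommRingCat.of ℂ)) (m : ℕ) (h : Z.functionField) (b : Fin 3 → Z.functionField)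
    (z : Z) (n : ℤ) : Prop :=
  h ≠ 0 ∧ ∃ k : ℤ, HasFormOrder π b z k ∧ n = Scheme.ord h z + m * k

/-- The discrepancy `a(X, E)` of the prime divisor `E` of the threefold `Y` with generic point `y`
is `q`. For some `m > 0` there is a rational section `ω = h (db₀ ∧ db₁ ∧ db₂)^{⊗ m}` that
generates `𝒪_X(m K_X)` at the generic point of `f(E)`, i.e. has order zero along all prime divisors
of `X` through that point, and the pullback of `ω` to `Y` has order `m q` along `E`.
The functions `h` and `bᵢ` are taken in the local ring of `X` at the image of the generic point of
`Y`, which is the function field of `X` when `f` is dominant. For normal `X` and birational `f` the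
number `q` does not depend on the choice of `m` and `ω`. -/
def HasDiscrepancy {X Y : Scheme.{0}} [IsIntegral X] [IsLocallyNoetherian X] [IsIntegral Y]
    [IsLocallyNoetherian Y] (π : X ⟶ Spec (CommRingCat.of ℂ)) (f : Y ⟶ X) (y : Y) (q : ℚ) : Prop :=
  ∃ (m : ℕ) (h : X.presheaf.stalk (f (genericPoint Y)))
    (b : Fin 3 → X.presheaf.stalk (f (genericPoint Y))) (n : ℤ), 0 < m ∧
    (∀ x : X, Order.coheight x = 1 → x ⤳ f y →
      HasPluriformOrder π m (algebraMap _ X.functionField h)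
        (fun i => algebraMap _ X.functionField (b i)) x 0) ∧
    HasPluriformOrder (f ≫ π) m ((f.stalkMap (genericPoint Y)).hom h)
      (fun i => (f.stalkMap (genericPoint Y)).hom (b i)) y n ∧
    (n : ℚ) = m * q

/-- The pullback to `Y` of an invariant polynomial, as a rational function on `Y`. -/
def pullbackFunction (r a : ℕ) [IsTerminalType r a] (g : invariants r a) :
    (economicResolution r a).functionField :=
  (economicResolution r a).presheaf.germ ⊤ (genericPoint (economicResolution r a)) trivial
    ((resolution r a).appTop ((Scheme.ΓSpecIso (CommRingCat.of (invariants r a))).inv g))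

/-- The vector `(1/r)(i a mod r, -i a mod r, i)`. -/
def divisorWeight (r a i : ℕ) : Fin 3 → ℚ :=
  ![(((i * a : ℤ) % r : ℤ) : ℚ) / r, (((-(i * a) : ℤ) % r : ℤ) : ℚ) / r, (i : ℚ) / r]

end CyclicQuotient

end

/-! The argument is toric. Exponents of invariant monomials form the lattice M, and a ray `v` of the
fan gives a divisor along which the monomial of exponent `m` has order `pair v m`.

Rays. In a cone ⟨p, q, s⟩ of type (1/r)(a, -a, 1), consider the vectors (1/r)(α p + (r - α) q + i s)
with 0 < i < r and α = ia mod r. The blow-up inserts the one with i = 1. Among the others, those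
with α < a form the same family for the subcone of index a, and those with α ≥ a form it for the
subcone of index r - a. By induction (`mem_maxCones_iff`, `mem_rays_iff`) the rays of the fan are
the three coordinate vectors and the r - 1 vectors v_i = `divisorWeight r a i`.

Divisors. The maximal cones are smooth, so on the chart of a single ray the ideal of elements of
positive order is generated by one monomial of a dual basis (`IsDualBasis.divisorIdeal_eq_span`);
the order along the divisor is therefore the minimum of the pairing over the support
(`IsDualBasis.isLeast_ord_rayPoint`). A height-one prime of a chart either avoids a monomial
positive on all rays, and then comes from the torus, or contains it, and then is the ideal of a ray
(`exists_face_of_height_eq_one`). This applies to Y and also to X, which is the chart of the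
non-smooth octant (`octantEquiv`). Over the torus and the coordinate rays the resolution is an open
immersion, so nothing is exceptional there. Each v_i has positive coordinates, so the prime under
its divisor strictly contains that of x = 0 and has height at least two
(`one_lt_coheight_resolution`).

Discrepancies. The form dx ∧ dy ∧ dz has weight a - a + 1 = 1, so its r-th power ω is invariant. Up
to a constant, ω = h (d(x^r) ∧ d(y^r) ∧ d(z^r))^{⊗ r} with h = (xyz)^{-r(r-1)}. In toric coordinates
t_l the three-form is a constant times (xyz)^r / (t₀t₁t₂) times dt₀ ∧ dt₁ ∧ dt₂, so ω has order r(Σ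
v_k - 1) along the divisor of `v` (`hasPluriformOrder_chart`). This vanishes for coordinate vectors,
so ω generates on X in codimension one; since v_i has coordinate sum 1 + i/r, the order along E_i is
i = r · (i/r). -/

noncomputable section
namespace CyclicQuotient

/-! ### The rays of the fan -/

/-- The vector `(1/r)(α p + (r - α) q + i s)`, where `α` is `i a` reduced modulo `r`. -/
def interiorRay (r a : ℕ) (p q s : Fin 3 → ℚ) (i : ℕ) : Fin 3 → ℚ :=
  (1 / (r : ℚ)) • (((i * a % r : ℕ) : ℚ) • p + ((r : ℚ) - (i * a % r : ℕ)) • q + (i : ℚ) • s)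

section step
variable {r a : ℕ} (p q s : Fin 3 → ℚ)

lemma interiorRay_one (h1 : a < r) : interiorRay r a p q s 1 =
    (1 / (r : ℚ)) • ((a : ℚ) • p + ((r : ℚ) - a) • q + s) := by
  simp [interiorRay, Nat.mod_eq_of_lt h1]

/-- Compare coefficients: `p` enters the subcone only through `w`, so the residue α is kept, and the
coefficient of `s` gives (α/r + j)/a = i/r, which is `hi`. -/
lemma interiorRay_left (h0 : 0 < a) (h1 : a < r) {i j α : ℕ} {a₂ : ℕ} (hi : i * a = α + j * r)
    (hα : i * a % r = α) (hα' : j * a₂ % a = α) :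
    interiorRay a a₂ ((1 / (r : ℚ)) • ((a : ℚ) • p + ((r : ℚ) - a) • q + s)) q s j =
      interiorRay r a p q s i := by
  have hr : (r : ℚ) ≠ 0 := by exact_mod_cast (by omega : r ≠ 0)
  have ha : (a : ℚ) ≠ 0 := by exact_mod_cast h0.ne'
  have hq : (i : ℚ) * a = α + j * r := by exact_mod_cast hi
  funext l
  simp only [interiorRay, hα, hα', Pi.smul_apply, Pi.add_apply, smul_eq_mul]
  field_simp
  linear_combination -(s l) * hq

/-- Here `w` replaces `q`. Its share of `p` turns the residue α of the subcone into a + α, and the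
coefficient of `s` gives ((r - a - α)/r + j)/(r - a) = i/r, which is `hi`. -/
lemma interiorRay_right (h1 : a < r) {i j α : ℕ} {a₃ : ℕ}
    (hi : i * (r - a) + α = (r - a) + j * r) (hα : i * a % r = a + α)
    (hα' : j * a₃ % (r - a) = α) :
    interiorRay (r - a) a₃ p ((1 / (r : ℚ)) • ((a : ℚ) • p + ((r : ℚ) - a) • q + s)) s j =
      interiorRay r a p q s i := by
  have hr : (r : ℚ) ≠ 0 := by exact_mod_cast (by omega : r ≠ 0)
  have hb : (r : ℚ) - a ≠ 0 := by
    have : (a : ℚ) < r := by exact_mod_cast h1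
    linarith
  have hq : (i : ℚ) * (r - a) + α = (r - a) + j * r := by
    have := congrArg (Nat.cast : ℕ → ℚ) hi
    push_cast [Nat.cast_sub h1.le] at this
    exact this
  funext l
  simp only [interiorRay, hα, hα', Pi.smul_apply, Pi.add_apply, smul_eq_mul, Nat.cast_sub h1.le,
    Nat.cast_add]
  field_simp
  linear_combination -(s l) * hq

/-- The indices correspond by i a = α + j r with 0 ≤ α < a, so that j = ⌊ia/r⌋. Since a₂ ≡ -r modulo
a, both sides have the same residue: j a₂ ≡ -j r ≡ α. -/
lemma interiorRay_left_iff (h0 : 0 < a) (h1 : a < r) {a₂ : ℕ} (ha₂ : a ∣ a₂ + r)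
    (v : Fin 3 → ℚ) :
    (∃ j, 1 ≤ j ∧ j < a ∧ v = interiorRay a a₂
      ((1 / (r : ℚ)) • ((a : ℚ) • p + ((r : ℚ) - a) • q + s)) q s j) ↔
    ∃ i, 1 ≤ i ∧ i < r ∧ i * a % r < a ∧ v = interiorRay r a p q s i := by
  obtain ⟨k, hk⟩ := ha₂
  constructor
  · rintro ⟨j, hj, hja, rfl⟩
    have hα := Nat.mod_lt (j * a₂) h0
    have hd := Nat.div_add_mod (j * a₂) a
    generalize j * a₂ / a = t at hd
    generalize hα' : j * a₂ % a = α at hα hd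
    -- The parent index is i = (α + j r)/a. It is an integer because a t + α + j r = j (a₂ + r), and
    -- a divides a₂ + r.
    obtain ⟨i, hi⟩ : a ∣ α + j * r :=
      (Nat.dvd_add_right (Dvd.intro t rfl)).1 (⟨j * k, by linear_combination hd + j * hk⟩ :
        a ∣ a * t + (α + j * r))
    have hi' : i * a = α + j * r := by rw [hi, mul_comm]
    have hα'' : i * a % r = α := by
      rw [hi', Nat.add_mul_mod_self_right, Nat.mod_eq_of_lt (hα.trans h1)]
    refine ⟨i, ?_, ?_, by omega, interiorRay_left p q s h0 h1 hi' hα'' hα'⟩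
    · rcases Nat.eq_zero_or_pos i with rfl | h
      · have := Nat.mul_pos hj (h0.trans h1); omega
      · exact h
    · by_contra h
      push Not at h
      have e1 := Nat.mul_le_mul_right a h
      have e2 := Nat.mul_le_mul_right r (Nat.succ_le_of_lt hja)
      have e3 : (j + 1) * r = j * r + r := by ring
      have e4 : a * r = r * a := mul_comm _ _
      simp only [Nat.succ_eq_add_one] at e2
      omega
  · rintro ⟨i, hi, hir, hα, rfl⟩
    have hd := Nat.div_add_mod (i * a) r
    have hα₀ : i * a % r < r := by omega
    generalize hj : i * a / r = j at hd
    generalize hα' : i * a % r = α at hα hd hα₀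
    have hi' : i * a = α + j * r := by rw [← hd]; ring
    -- The witness is j = ⌊ia/r⌋; j = 0 would give i a = α < a.
    refine ⟨j, ?_, ?_, (interiorRay_left p q s h0 h1 hi' hα' ?_).symm⟩
    · rcases Nat.eq_zero_or_pos j with rfl | h
      · have := Nat.mul_le_mul_right a hi; omega
      · exact h
    · by_contra h
      push Not at h
      have e1 := Nat.mul_le_mul_right r h
      have e2 := Nat.mul_le_mul_right a (Nat.succ_le_of_lt hir)
      have e3 : (i + 1) * a = i * a + a := by ring
      have e4 : a * r = r * a := mul_comm _ _
      simp only [Nat.succ_eq_add_one] at e2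
      omega
    · have : (j * a₂ + i * a) % a = (α + a * (j * k)) % a := by
        congr 1; linear_combination hi' + j * hk
      rwa [Nat.add_mul_mod_self_right, Nat.add_mul_mod_self_left, Nat.mod_eq_of_lt hα] at this

/-- With b = r - a and residue a + α, the indices correspond by i b + α = b + j r, that is j = i - 1
- ⌊ia/r⌋. The index i = 1, whose residue is a, would give j = 0: it is the vector `w`, a generator
of the subcone. -/
lemma interiorRay_right_iff (h0 : 0 < a) (h1 : a < r) (v : Fin 3 → ℚ) :
    (∃ j, 1 ≤ j ∧ j < r - a ∧ v = interiorRay (r - a) (r % (r - a)) p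
      ((1 / (r : ℚ)) • ((a : ℚ) • p + ((r : ℚ) - a) • q + s)) s j) ↔
    ∃ i, 1 ≤ i ∧ i < r ∧ (a ≤ i * a % r ∧ i ≠ 1) ∧ v = interiorRay r a p q s i := by
  obtain ⟨b, hb⟩ : ∃ b, b = r - a := ⟨_, rfl⟩
  have hrb : r = a + b := by omega
  have hb0 : 0 < b := by omega
  have hmod : ∀ j, j * (r % (r - a)) % (r - a) = j * r % b := fun j => by
    rw [← hb, Nat.mul_mod_mod]
  constructor
  · rintro ⟨j, hj, hjb, rfl⟩
    have hα := Nat.mod_lt (j * r) hb0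
    have hd := Nat.div_add_mod (j * r) b
    generalize j * r / b = t at hd
    generalize hα' : j * r % b = α at hα hd
    -- The parent index is i = ⌊jr/b⌋ + 1; since r > b, it exceeds j, hence differs from 1.
    have hi : (t + 1) * (r - a) + α = (r - a) + j * r := by
      rw [← hb]; linear_combination hd
    have htj : j ≤ t := by
      by_contra h
      push Not at h
      have e1 := Nat.mul_le_mul_left b (Nat.succ_le_of_lt h)
      have e3 : j * r = j * a + b * j := by rw [hrb]; ring
      have e4 : b * (t + 1) = b * t + b := by ring
      simp only [Nat.succ_eq_add_one] at e1
      omega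
    have hia : (t + 1) * a = (a + α) + (t - j) * r := by
      obtain ⟨u, rfl⟩ := Nat.exists_eq_add_of_le htj
      rw [Nat.add_sub_cancel_left]
      have : (j + u) * a + b * (j + u) + α = α + j * r + u * r := by rw [hrb]; ring
      have e : (j + u + 1) * a = (j + u) * a + a := by ring
      omega
    have hα'' : (t + 1) * a % r = a + α := by
      rw [hia, Nat.add_mul_mod_self_right, Nat.mod_eq_of_lt (by omega)]
    refine ⟨t + 1, by omega, ?_, ⟨by omega, ?_⟩,
      interiorRay_right p q s h1 hi hα'' ((hmod j).trans hα')⟩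
    · by_contra h
      push Not at h
      have e1 := Nat.mul_le_mul_left b h
      have e2 := Nat.mul_le_mul_right r (Nat.succ_le_of_lt (hb ▸ hjb))
      have e3 : (j + 1) * r = j * r + r := by ring
      have e4 : b * (t + 1) = b * t + b := by ring
      simp only [Nat.succ_eq_add_one] at e2
      omega
    · omega
  · rintro ⟨i, hi, hir, ⟨hα, hi1⟩, rfl⟩
    have hd := Nat.div_add_mod (i * a) r
    have hα₀ : i * a % r < r := Nat.mod_lt _ (by omega)
    generalize i * a / r = k at hd
    obtain ⟨α, hα'⟩ := Nat.exists_eq_add_of_le hα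
    rw [hα'] at hα₀ hd
    have hki : k + 1 ≤ i := by
      by_contra h
      push Not at h
      have e1 := Nat.mul_le_mul_left r (Nat.lt_succ_iff.1 h)
      have e2 : r * i = i * a + i * b := by rw [hrb]; ring
      omega
    obtain ⟨j, rfl⟩ := Nat.exists_eq_add_of_le hki
    have hb' : (k + 1 + j) * b + α = b + j * r := by
      have : (k + 1 + j) * a + (k + 1 + j) * b = r * k + (a + b) + j * r := by rw [hrb]; ring
      omega
    have hjr : (j * r) % b = α := by
      have : (j * r + b) % b = (α + (k + 1 + j) * b) % b := by
        congr 1; linear_combination -hb'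
      rwa [Nat.add_mod_right, Nat.add_mul_mod_self_right,
        Nat.mod_eq_of_lt (show α < b by omega)] at this
    refine ⟨j, ?_, ?_, (interiorRay_right p q s h1 (hb ▸ hb') hα' ((hmod j).trans hjr)).symm⟩
    -- If j = 0 then i = k + 1 and k b + α = 0, so k = 0 and i = 1, the excluded index.
    · rcases Nat.eq_zero_or_pos j with rfl | h
      · have hk : 1 ≤ k := by omega
        have e1 := Nat.mul_le_mul_right b hk
        have e2 : (k + 1 + 0) * b = k * b + b := by ring
        omega
      · exact h
    · rw [← hb]
      by_contra h
      push Not at h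
      have e1 := Nat.mul_le_mul_right r h
      have e2 := Nat.mul_le_mul_right b (Nat.succ_le_of_lt hir)
      have e3 : (k + 1 + j + 1) * b = (k + 1 + j) * b + b := by ring
      have e4 : b * r = r * b := mul_comm _ _
      simp only [Nat.succ_eq_add_one] at e2
      omega

end step

/-- Coprimality passes to both subcones. It keeps the induction going and forces r = 1 where the
recursion stops. -/
lemma coprime_left {r a : ℕ} (h0 : 0 < a) (hcop : Nat.Coprime a r) :
    Nat.Coprime ((-(r : ℤ)) % a).toNat a := by
  have h2 := Int.toNat_of_nonneg (Int.emod_nonneg (-(r : ℤ)) (b := a) (by omega))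
  rw [← Nat.isCoprime_iff_coprime, h2, Int.emod_def]
  obtain ⟨u, v, e⟩ := Nat.isCoprime_iff_coprime.2 hcop
  exact ⟨-v, u - v * (-(r : ℤ) / a), by linear_combination e⟩

lemma coprime_right {r a : ℕ} (h1 : a < r) (hcop : Nat.Coprime a r) :
    Nat.Coprime (r % (r - a)) (r - a) := by
  unfold Nat.Coprime
  rw [← Nat.gcd_rec]
  have h3 := (Nat.coprime_sub_self_left h1.le).2 (Nat.Coprime.symm hcop)
  have : Nat.Coprime (r - a) r := by
    have h4 : r = (r - a) + a := by omega
    rw [h4]; simpa using h3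
  exact this

/-- The rays of the cones obtained by repeated weighted blow-ups. -/
lemma mem_maxCones_iff (r a : ℕ) (p q s : Fin 3 → ℚ) (hcop : Nat.Coprime a r) (hlt : a < r)
    (v : Fin 3 → ℚ) :
    (∃ c ∈ maxCones r a p q s, v ∈ ({c.1, c.2.1, c.2.2} : Set (Fin 3 → ℚ))) ↔
      v ∈ ({p, q, s} : Set (Fin 3 → ℚ)) ∨
        ∃ i, 1 ≤ i ∧ i < r ∧ v = interiorRay r a p q s i := by
  induction r using Nat.strong_induction_on generalizing a p q s with
  | _ r ih =>
  rw [maxCones]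
  split_ifs with h01
  · obtain ⟨h0, h1⟩ := h01
    have ha₂ : a ∣ ((-(r : ℤ)) % a).toNat + r := by
      have h2 := Int.toNat_of_nonneg (Int.emod_nonneg (-(r : ℤ)) (b := a) (by omega))
      zify
      rw [h2, Int.emod_def]
      exact ⟨-(-(r : ℤ) / a), by ring⟩
    have hlt₂ : ((-(r : ℤ)) % a).toNat < a := by
      have := Int.emod_lt_of_pos (-(r : ℤ)) (b := a) (by omega)
      have h2 := Int.emod_nonneg (-(r : ℤ)) (b := a) (by omega)
      omega
    have hL := ih a h1 _ ((1 / (r : ℚ)) • ((a : ℚ) • p + ((r : ℚ) - a) • q + s)) q s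
      (coprime_left h0 hcop) hlt₂
    have hR := ih (r - a) (by omega) _ p ((1 / (r : ℚ)) • ((a : ℚ) • p + ((r : ℚ) - a) • q + s)) s
      (coprime_right h1 hcop) (Nat.mod_lt _ (by omega))
    rw [interiorRay_left_iff p q s h0 h1 ha₂] at hL
    rw [interiorRay_right_iff p q s h0 h1] at hR
    have hw := interiorRay_one p q s h1
    simp only [List.mem_append, List.mem_singleton, or_and_right, exists_or, exists_eq_left, hL, hR]
    rw [← hw]
    simp only [Set.mem_insert_iff, Set.mem_singleton_iff]
    constructor
    · rintro ((((rfl | rfl | rfl) | ⟨i, hi, hi', -, rfl⟩) |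
        ((rfl | rfl | rfl) | ⟨i, hi, hi', -, rfl⟩)) | (rfl | rfl | rfl))
      all_goals first
        | exact Or.inr ⟨i, hi, hi', rfl⟩
        | exact Or.inr ⟨1, le_rfl, by omega, rfl⟩
        | exact Or.inl (Or.inl rfl)
        | exact Or.inl (Or.inr (Or.inl rfl))
        | exact Or.inl (Or.inr (Or.inr rfl))
    · rintro ((rfl | rfl | rfl) | ⟨i, hi, hi', rfl⟩)
      · simp
      · simp
      · simp
      -- Index 1 is `w`; every other index goes to the left or right subcone according to whether
      -- its residue is below a.
      · by_cases hi1 : i = 1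
        · subst hi1; simp
        · rcases lt_or_ge (i * a % r) a with h | h
          · exact Or.inl (Or.inl (Or.inr ⟨i, hi, hi', h, rfl⟩))
          · exact Or.inl (Or.inr (Or.inr ⟨i, hi, hi', ⟨h, hi1⟩, rfl⟩))
  -- The recursion stops only at a = 0; coprimality then gives r = 1, and there is no index 1 ≤ i <
  -- r.
  · have ha : a = 0 := by omega
    subst ha
    have : r = 1 := by simpa using hcop
    subst this
    simp only [List.mem_singleton, exists_eq_left]
    constructor
    · exact Or.inl
    · rintro (h | ⟨i, hi, hi', -⟩)
      · exact h
      · omega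

lemma mul_mod_ne_zero {r a : ℕ} [IsTerminalType r a] {i : ℕ} (hi : 1 ≤ i) (hi' : i < r) :
    i * a % r ≠ 0 := fun h => by
  have hd := (Nat.Coprime.symm (IsTerminalType.coprime (r := r) (a := a))).dvd_of_dvd_mul_right
    (Nat.dvd_of_mod_eq_zero h)
  exact absurd (Nat.le_of_dvd hi hd) (by omega)

/-- Since a is prime to r, ia mod r is nonzero for 0 < i < r, so the residue of -ia is r minus that
of ia. This makes the coordinates positive with sum 1 + i/r. -/
lemma divisorWeight_eq {r a : ℕ} [IsTerminalType r a] {i : ℕ} (hi : 1 ≤ i) (hi' : i < r) :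
    divisorWeight r a i =
      ![((i * a % r : ℕ) : ℚ) / r, ((r : ℚ) - (i * a % r : ℕ)) / r, (i : ℚ) / r] := by
  have h := mul_mod_ne_zero (a := a) hi hi'
  have hlt := Nat.mod_lt (i * a) (show r > 0 by omega)
  have h1 : ((i * a : ℤ) % r) = ((i * a % r : ℕ) : ℤ) := by push_cast; rfl
  have h2 : ((-(i * a : ℤ)) % r) = (r : ℤ) - ((i * a % r : ℕ) : ℤ) := by
    rw [Int.emod_eq_iff (by omega)]
    refine ⟨by omega, by simp; omega, ?_⟩
    refine ⟨1 + (i * a / r : ℕ), ?_⟩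
    have := Nat.div_add_mod (i * a) r
    zify at this ⊢
    linear_combination -this
  rw [divisorWeight, h1, h2]
  push_cast
  rfl

/-- The rays of the fan are the coordinate vectors and the vectors
`(1/r)(i a mod r, -i a mod r, i)`. -/
lemma mem_rays_iff {r a : ℕ} [IsTerminalType r a] (v : Fin 3 → ℚ) :
    (∃ c ∈ fanMax r a, v ∈ ({c.1, c.2.1, c.2.2} : Set (Fin 3 → ℚ))) ↔
      (∃ k, v = Pi.single k 1) ∨ ∃ i, 1 ≤ i ∧ i < r ∧ v = divisorWeight r a i := by
  rw [fanMax, mem_maxCones_iff r a _ _ _ IsTerminalType.coprime IsTerminalType.lt]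
  refine or_congr ?_ (exists_congr fun i => and_congr_right fun hi => and_congr_right fun hi' => ?_)
  · simp [Fin.exists_fin_succ]
  · have : interiorRay r a (Pi.single 0 1) (Pi.single 1 1) (Pi.single 2 1) i =
        divisorWeight r a i := by
      rw [divisorWeight_eq hi hi']
      funext l
      fin_cases l <;> simp [interiorRay] <;> ring
    rw [this]


/-! ### Monomials and monomial primes of the chart rings -/

section chartRing
variable {r a : ℕ} {σ : Set (Fin 3 → ℚ)}

/-- A monomial in a chart ring. -/
def chi (m : Fin 3 → ℤ) (hm : m ∈ dualMonoid r a σ) : chartRing r a σ :=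
  ⟨AddMonoidAlgebra.single m 1, single_mem hm 1⟩

lemma chi_congr {m n : Fin 3 → ℤ} (h : m = n) (hm : m ∈ dualMonoid r a σ)
    (hn : n ∈ dualMonoid r a σ) : chi m hm = chi n hn := by subst h; rfl

lemma chi_mul {m n : Fin 3 → ℤ} (hm : m ∈ dualMonoid r a σ) (hn : n ∈ dualMonoid r a σ) :
    chi m hm * chi n hn = chi (m + n) (add_mem hm hn) := by
  apply Subtype.ext
  change (AddMonoidAlgebra.single m 1 * AddMonoidAlgebra.single n 1 : Laurent) = _
  rw [AddMonoidAlgebra.single_mul_single, one_mul]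
  rfl

lemma chi_pow {m : Fin 3 → ℤ} (hm : m ∈ dualMonoid r a σ) (n : ℕ) :
    chi m hm ^ n = chi (n • m) (nsmul_mem hm n) := by
  apply Subtype.ext
  change (AddMonoidAlgebra.single m 1 : Laurent) ^ n = _
  rw [AddMonoidAlgebra.single_pow, one_pow]
  rfl

lemma chi_zero : chi 0 (zero_mem _) = (1 : chartRing r a σ) := rfl

lemma chi_ne_zero {m : Fin 3 → ℤ} (hm : m ∈ dualMonoid r a σ) : chi m hm ≠ 0 := fun h => by
  have := congrArg Subtype.val h
  simp [chi] at this

lemma isUnit_chi {m : Fin 3 → ℤ} (hm : m ∈ dualMonoid r a σ) (hm' : -m ∈ dualMonoid r a σ) :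
    IsUnit (chi m hm) := by
  refine IsUnit.of_mul_eq_one (chi (-m) hm') ?_
  rw [chi_mul, ← chi_zero]
  exact chi_congr (by simp) _ _

/-- Every element of a chart ring is a combination of the monomials in its support. -/
lemma eq_sum_chi (f : chartRing r a σ) :
    f = ∑ m ∈ f.1.coeff.support.attach, f.1.coeff m.1 • chi m.1 (f.2 m.1 m.2) := by
  apply Subtype.ext
  rw [AddSubmonoidClass.coe_finsetSum]
  have : f.1 = ∑ m ∈ f.1.coeff.support, AddMonoidAlgebra.single m (f.1.coeff m) := by
    conv_lhs => rw [← AddMonoidAlgebra.sum_coeff_single f.1]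
    rfl
  conv_lhs => rw [this]
  rw [← Finset.sum_attach]
  refine Finset.sum_congr rfl fun m _ => ?_
  simp [chi]

lemma mem_of_chi_mem {I : Ideal (chartRing r a σ)} {f : chartRing r a σ}
    (h : ∀ m (hm : m ∈ f.1.coeff.support), chi m (f.2 m hm) ∈ I) : f ∈ I := by
  rw [eq_sum_chi f]
  refine sum_mem fun m _ => ?_
  rw [Algebra.smul_def]
  exact I.mul_mem_left _ (h m.1 m.2)

/-- The ideal of the elements of positive order along the ray `v`. -/
def divisorIdeal (r a : ℕ) {σ : Set (Fin 3 → ℚ)} {v : Fin 3 → ℚ} (hv : v ∈ σ) :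
    Ideal (chartRing r a σ) where
  carrier := {f | ∀ m ∈ f.1.coeff.support, 0 < pair v m}
  zero_mem' := by intro m hm; simp at hm
  add_mem' {f g} hf hg := by
    intro m hm
    classical
    rcases Finset.mem_union.1 (Finsupp.support_add (g₁ := f.1.coeff) (g₂ := g.1.coeff) hm) with h | h
    · exact hf m h
    · exact hg m h
  smul_mem' f g hg := by
    intro m hm
    classical
    obtain ⟨x, hx, y, hy, rfl⟩ :=
      Finset.mem_add.1 (AddMonoidAlgebra.support_coeff_mul_subset f.1 g.1 hm)
    rw [pair_add]
    exact add_pos_of_nonneg_of_pos ((f.2 x hx).2 v hv) (hg y hy)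

lemma mem_divisorIdeal {v : Fin 3 → ℚ} (hv : v ∈ σ) {f : chartRing r a σ} :
    f ∈ divisorIdeal r a hv ↔ ∀ m ∈ f.1.coeff.support, 0 < pair v m := Iff.rfl

lemma chi_mem_divisorIdeal {v : Fin 3 → ℚ} (hv : v ∈ σ) {m : Fin 3 → ℤ}
    (hm : m ∈ dualMonoid r a σ) : chi m hm ∈ divisorIdeal r a hv ↔ 0 < pair v m := by
  rw [mem_divisorIdeal]
  have : (chi m hm).1.coeff.support = {m} := by
    change (Finsupp.single m (1 : ℂ)).support = _
    exact Finsupp.support_single (hb := one_ne_zero) ..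
  simp [this]

/-- The part of order zero along the ray `v`. -/
def zeroPart (v : Fin 3 → ℚ) (f : chartRing r a σ) : chartRing r a σ :=
  ⟨.ofCoeff (f.1.coeff.filter fun m => pair v m = 0), fun m hm => by
    rw [AddMonoidAlgebra.coeff_ofCoeff, Finsupp.support_filter] at hm
    exact f.2 m (Finset.mem_filter.1 hm).1⟩

lemma mem_support_zeroPart {v : Fin 3 → ℚ} {f : chartRing r a σ} {m : Fin 3 → ℤ} :
    m ∈ (zeroPart v f).1.coeff.support ↔ m ∈ f.1.coeff.support ∧ pair v m = 0 := by
  rw [zeroPart, AddMonoidAlgebra.coeff_ofCoeff, Finsupp.support_filter, Finset.mem_filter]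

lemma sub_zeroPart_mem {v : Fin 3 → ℚ} (hv : v ∈ σ) (f : chartRing r a σ) :
    f - zeroPart v f ∈ divisorIdeal r a hv := by
  rw [mem_divisorIdeal]
  intro m hm
  have hc : (f - zeroPart v f).1.coeff m =
      f.1.coeff m - (f.1.coeff.filter fun m => pair v m = 0) m := rfl
  rw [Finsupp.mem_support_iff, hc, Finsupp.filter_apply] at hm
  split_ifs at hm with h0
  · simp at hm
  · rw [sub_zero, ← Finsupp.mem_support_iff] at hm
    exact lt_of_le_of_ne ((f.2 m hm).2 v hv) (Ne.symm h0)

lemma mem_divisorIdeal_iff_zeroPart {v : Fin 3 → ℚ} (hv : v ∈ σ) {f : chartRing r a σ} :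
    f ∈ divisorIdeal r a hv ↔ zeroPart v f = 0 := by
  constructor
  · intro h
    by_contra h0
    have : (zeroPart v f).1.coeff ≠ 0 := fun h1 =>
      h0 (Subtype.ext (AddMonoidAlgebra.coeff_eq_zero.1 h1))
    obtain ⟨m, hm⟩ := Finsupp.support_nonempty_iff.2 this
    rw [mem_support_zeroPart] at hm
    exact (h m hm.1).ne' hm.2
  · intro h
    have := sub_zeroPart_mem hv f
    rwa [h, sub_zero] at this

/-- Modulo the ideal, an element equals its part of order zero. The product of two such parts is
supported where the pairing vanishes, so if it lies in the ideal it is zero; the chart ring being a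
domain, one factor vanishes. -/
instance divisorIdeal_isPrime {v : Fin 3 → ℚ} (hv : v ∈ σ) : (divisorIdeal r a hv).IsPrime := by
  constructor
  · rw [Ne, Ideal.eq_top_iff_one, ← chi_zero, chi_mem_divisorIdeal]
    simp [pair]
  · intro f g hfg
    have h1 : zeroPart v f * zeroPart v g ∈ divisorIdeal r a hv := by
      have : zeroPart v f * zeroPart v g =
          f * g - (f - zeroPart v f) * g - zeroPart v f * (g - zeroPart v g) := by ring
      rw [this]
      exact sub_mem (sub_mem hfg (Ideal.mul_mem_right _ _ (sub_zeroPart_mem hv f)))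
        (Ideal.mul_mem_left _ _ (sub_zeroPart_mem hv g))
    have h2 : zeroPart v f * zeroPart v g = 0 := by
      by_contra h0
      have : (zeroPart v f * zeroPart v g).1.coeff ≠ 0 := fun h1 =>
        h0 (Subtype.ext (AddMonoidAlgebra.coeff_eq_zero.1 h1))
      obtain ⟨m, hm⟩ := Finsupp.support_nonempty_iff.2 this
      have hpos := h1 m hm
      classical
      obtain ⟨x, hx, y, hy, rfl⟩ := Finset.mem_add.1 (AddMonoidAlgebra.support_coeff_mul_subset
        (zeroPart v f).1 (zeroPart v g).1 hm)
      rw [mem_support_zeroPart] at hx hy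
      rw [pair_add, hx.2, hy.2] at hpos
      simp at hpos
    simp only [mem_divisorIdeal_iff_zeroPart]
    exact mul_eq_zero.1 h2

/-- A prime containing a monomial that is positive on all rays contains the ideal of a ray. -/
lemma exists_divisorIdeal_le (hσ : σ.Finite) {m₀ : Fin 3 → ℤ} (hm₀ : m₀ ∈ dualMonoid r a σ)
    {P : Ideal (chartRing r a σ)} [hP : P.IsPrime] (hmem : chi m₀ hm₀ ∈ P) :
    ∃ v, ∃ hv : v ∈ σ, divisorIdeal r a hv ≤ P := by
  classical
  have hall : ∀ f : chartRing r a σ, (∀ v (hv : v ∈ σ), f ∈ divisorIdeal r a hv) → f ∈ P := by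
    intro f hf
    refine mem_of_chi_mem fun m hm => ?_
    -- The exponent `m` is positive on every ray, so a large multiple dominates `m₀`; then χ^{m₀}
    -- divides a power of χ^m, and primality gives χ^m ∈ P.
    obtain ⟨N, hN⟩ : ∃ N : ℕ, ∀ v ∈ σ, pair v m₀ ≤ N * pair v m := by
      obtain ⟨N, hN⟩ := exists_nat_ge (∑ v ∈ hσ.toFinset, pair v m₀ / pair v m)
      refine ⟨N, fun v hv => ?_⟩
      have h1 := hf v hv m hm
      rw [← div_le_iff₀ h1]
      refine le_trans (Finset.single_le_sum (f := fun v => pair v m₀ / pair v m) (fun u hu => ?_)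
        (hσ.mem_toFinset.2 hv)) hN
      rw [hσ.mem_toFinset] at hu
      exact div_nonneg (hm₀.2 u hu) (hf u hu m hm).le
    refine hP.mem_of_pow_mem N ?_
    have hsub : N • m - m₀ ∈ dualMonoid r a σ := by
      refine ⟨sub_mem (nsmul_mem (f.2 m hm).1 N) hm₀.1, fun v hv => ?_⟩
      rw [sub_eq_add_neg, pair_add, pair_neg, pair_nsmul]
      linarith [hN v hv]
    have : chi m (f.2 m hm) ^ N = chi (N • m - m₀) hsub * chi m₀ hm₀ := by
      rw [chi_pow, chi_mul]
      exact chi_congr (by simp) _ _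
    rw [this]
    exact P.mul_mem_left _ hmem
  -- A prime containing a finite intersection of ideals contains one of them.
  have hinf : (hσ.toFinset.attach.inf fun v => divisorIdeal r a (hσ.mem_toFinset.1 v.2)) ≤ P := by
    intro f hf
    rw [Submodule.mem_finsetInf] at hf
    exact hall f fun v hv => hf ⟨v, hσ.mem_toFinset.2 hv⟩ (Finset.mem_attach _ _)
  obtain ⟨v, -, hv⟩ := hP.inf_le'.1 hinf
  exact ⟨v.1, hσ.mem_toFinset.1 v.2, hv⟩

/-- The inclusion of a chart ring into the ring of a face. -/
abbrev faceHom {τ : Set (Fin 3 → ℚ)} (h : τ ⊆ σ) : chartRing r a σ →+* chartRing r a τ :=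
  (Subalgebra.inclusion (chartRing_anti (r := r) (a := a) h)).toRingHom

/-- A prime of height one either comes from the torus or is the ideal of a ray. -/
lemma exists_face_of_height_eq_one (hσ : σ.Finite) {m₀ : Fin 3 → ℤ} (hm₀ : m₀ ∈ latticeM r a)
    (hpos : ∀ v ∈ σ, 1 ≤ pair v m₀) (P : PrimeSpectrum (chartRing r a σ))
    (hP : P.asIdeal.height = 1) :
    (∃ Q : PrimeSpectrum (chartRing r a ∅),
        PrimeSpectrum.comap (faceHom (Set.empty_subset σ)) Q = P) ∨
      ∃ v, ∃ hv : v ∈ σ, PrimeSpectrum.comap (faceHom (Set.singleton_subset_iff.2 hv))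
        ⟨divisorIdeal r a (Set.mem_singleton v), inferInstance⟩ = P := by
  have hm : m₀ ∈ dualMonoid r a σ :=
    ⟨hm₀, fun v hv => zero_le_one.trans (hpos v hv)⟩
  by_cases hmem : chi m₀ hm ∈ P.asIdeal
  · right
    obtain ⟨v, hv, hle⟩ := exists_divisorIdeal_le hσ hm hmem
    refine ⟨v, hv, ?_⟩
    apply PrimeSpectrum.ext
    change divisorIdeal r a hv = P.asIdeal
    -- A strict inclusion would give a chain of primes 0 < `divisorIdeal` < P, against height one.
    by_contra hne
    have hlt : divisorIdeal r a hv < P.asIdeal := lt_of_le_of_ne hle hne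
    have hbot : (⊥ : Ideal (chartRing r a σ)) < divisorIdeal r a hv := by
      rw [bot_lt_iff_ne_bot]
      intro h0
      have : chi m₀ hm ∈ divisorIdeal r a hv :=
        (chi_mem_divisorIdeal hv hm).2 (zero_lt_one.trans_le (hpos v hv))
      rw [h0] at this
      exact chi_ne_zero hm this
    have h1 := Ideal.height_add_one_le_of_lt_of_isPrime hbot
    have h2 := Ideal.height_add_one_le_of_lt_of_isPrime hlt
    rw [hP] at h2
    have h3 := (add_le_add_left (le_add_self.trans h1) 1).trans h2
    exact absurd h3 (by decide)
  -- Inverting a monomial positive on every ray gives the torus, so a prime avoiding it comes from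
  -- there.
  · left
    let _ := (faceHom (r := r) (a := a) (Set.empty_subset σ)).toAlgebra
    have : IsLocalization.Away (chi m₀ hm) (chartRing r a ∅) :=
      isLocalization_face (Set.empty_subset σ) hm₀ (by simp) (fun v hv _ => hpos v hv) hm hσ
    have hr := PrimeSpectrum.localization_away_comap_range (chartRing r a ∅) (chi m₀ hm)
    have : P ∈ Set.range (PrimeSpectrum.comap (algebraMap (chartRing r a σ) (chartRing r a ∅))) := by
      rw [hr]; exact hmem
    exact this

end chartRing


/-! ### Dual bases -/

/-- `μ` is a basis of the lattice `M`, dual to the vectors `ρ`. -/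
structure IsDualBasis (r a : ℕ) (ρ : Fin 3 → Fin 3 → ℚ) (μ : Fin 3 → Fin 3 → ℤ) : Prop where
  mem : ∀ j, μ j ∈ latticeM r a
  pair_eq : ∀ i j, pair (ρ i) (μ j) = if i = j then 1 else 0
  span : ∀ m ∈ latticeM r a, ∃ k : Fin 3 → ℤ, (∀ l, pair (ρ l) m = k l) ∧ m = ∑ l, k l • μ l

/-- For index 1 the congruence on the three pairings is empty, so every unit triple is realized by
an exponent of M. -/
lemma IsCone.exists_isDualBasis {r a : ℕ} {p q s : Fin 3 → ℚ} (h : IsCone r a 1 0 p q s) :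
    ∃ μ, IsDualBasis r a ![p, q, s] μ := by
  obtain ⟨mp, hmp, p1, p2, p3⟩ := h.surj 1 0 0 (by simp)
  obtain ⟨mq, hmq, q1, q2, q3⟩ := h.surj 0 1 0 (by simp)
  obtain ⟨ms, hms, s1, s2, s3⟩ := h.surj 0 0 1 (by simp)
  refine ⟨![mp, mq, ms], ?_, ?_, ?_⟩
  · intro j; fin_cases j <;> assumption
  · intro i j; fin_cases i <;> fin_cases j <;> simp [*]
  · intro m hm
    obtain ⟨α, β, γ, hα, hβ, hγ, -⟩ := h.int m hm
    refine ⟨![α, β, γ], ?_, ?_⟩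
    · intro l; fin_cases l <;> simp [*]
    · rw [Fin.sum_univ_three]
      change m = α • mp + β • mq + γ • ms
      have hM : m - (α • mp + β • mq + γ • ms) ∈ latticeM r a :=
        sub_mem hm (add_mem (add_mem (zsmul_mem hmp _) (zsmul_mem hmq _)) (zsmul_mem hms _))
      refine sub_eq_zero.1 (h.inj _ hM ?_ ?_ ?_) <;>
        rw [sub_eq_add_neg, pair_add, pair_neg, pair_add, pair_add, pair_zsmul, pair_zsmul,
          pair_zsmul]
      · rw [hα, p1, q1, s1]; push_cast; ring
      · rw [hβ, p2, q2, s2]; push_cast; ring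
      · rw [hγ, p3, q3, s3]; push_cast; ring

lemma exists_isDualBasis_fan {r a : ℕ} [IsTerminalType r a] (τ : Fan r a) :
    ∃ ρ μ, IsDualBasis r a ρ μ ∧ τ.1 ⊆ Set.range ρ := by
  obtain ⟨c, hc, hτ⟩ := τ.2
  obtain ⟨μ, hμ⟩ := (isCone_fan hc).exists_isDualBasis
  refine ⟨_, μ, hμ, hτ.trans ?_⟩
  rintro v (rfl | rfl | rfl)
  exacts [⟨0, rfl⟩, ⟨1, rfl⟩, ⟨2, rfl⟩]

namespace IsDualBasis
variable {r a : ℕ} {ρ : Fin 3 → Fin 3 → ℚ} {μ : Fin 3 → Fin 3 → ℤ} (h : IsDualBasis r a ρ μ)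
include h

lemma pair_int (l : Fin 3) {m : Fin 3 → ℤ} (hm : m ∈ latticeM r a) : ∃ k : ℤ, pair (ρ l) m = k := by
  obtain ⟨k, hk, -⟩ := h.span m hm
  exact ⟨k l, hk l⟩

lemma mem_dualMonoid {τ : Set (Fin 3 → ℚ)} (hτ : τ ⊆ Set.range ρ) (j : Fin 3) :
    μ j ∈ dualMonoid r a τ := by
  refine ⟨h.mem j, fun v hv => ?_⟩
  obtain ⟨i, rfl⟩ := hτ hv
  rw [h.pair_eq]
  split_ifs <;> norm_num

lemma mem_dualMonoid_ray (l : Fin 3) : μ l ∈ dualMonoid r a {ρ l} :=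
  h.mem_dualMonoid (by simp) l

/-- Smoothness enters here: the pairing with `ρ l` is integral on M, so a positive value is at least
1 = `pair (ρ l) (μ l)`, and χ^{μ l} divides the monomial. Only this one ray constrains the quotient.
-/
lemma divisorIdeal_eq_span (l : Fin 3) :
    divisorIdeal r a (Set.mem_singleton (ρ l)) =
      Ideal.span {chi (μ l) (h.mem_dualMonoid_ray l)} := by
  apply le_antisymm
  · intro f hf
    refine mem_of_chi_mem fun m hm => ?_
    have hpos := hf m hm
    obtain ⟨k, hk⟩ := h.pair_int l (f.2 m hm).1
    have hk1 : (1 : ℚ) ≤ k := by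
      rw [hk] at hpos
      exact_mod_cast hpos
    have hsub : m - μ l ∈ dualMonoid r a {ρ l} := by
      refine ⟨sub_mem (f.2 m hm).1 (h.mem l), ?_⟩
      rintro v rfl
      rw [sub_eq_add_neg, pair_add, pair_neg, hk, h.pair_eq, if_pos rfl]
      linarith
    have : chi m (f.2 m hm) = chi (m - μ l) hsub * chi (μ l) (h.mem_dualMonoid_ray l) := by
      rw [chi_mul]; exact chi_congr (by simp) _ _
    rw [this]
    exact Ideal.mul_mem_left _ _ (Ideal.mem_span_singleton_self _)
  · rw [Ideal.span_singleton_le_iff_mem, chi_mem_divisorIdeal, h.pair_eq, if_pos rfl]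
    exact zero_lt_one

/-- A nonzero element of the ring of a ray is a power of the uniformizer times an element of order
zero. -/
lemma exists_eq_pow_mul (l : Fin 3) {f : chartRing r a {ρ l}} (hf : f ≠ 0) :
    ∃ (n : ℕ) (g : chartRing r a {ρ l}), g ∉ divisorIdeal r a (Set.mem_singleton (ρ l)) ∧
      f = chi (μ l) (h.mem_dualMonoid_ray l) ^ n * g ∧
      IsLeast (pair (ρ l) '' f.1.coeff.support) n := by
  have hne : f.1.coeff.support.Nonempty := by
    rw [Finsupp.support_nonempty_iff]
    exact fun h1 => hf (Subtype.ext (AddMonoidAlgebra.coeff_eq_zero.1 h1))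
  -- The exponent n is the least pairing on the support. Dividing by the n-th power of the
  -- uniformizer turns the term at `m₀` into one of order zero, so the quotient leaves the ideal.
  obtain ⟨m₀, hm₀, hmin⟩ := f.1.coeff.support.exists_min_image (pair (ρ l)) hne
  obtain ⟨k, hk⟩ := h.pair_int l (f.2 m₀ hm₀).1
  have hk0 : 0 ≤ k := by
    have := (f.2 m₀ hm₀).2 _ (Set.mem_singleton _)
    rw [hk] at this
    exact_mod_cast this
  obtain ⟨n, rfl⟩ := Int.eq_ofNat_of_zero_le hk0
  rw [Int.cast_natCast] at hk
  have hsupp : ∀ m, (f.1 * AddMonoidAlgebra.single (-(n • μ l)) 1 : Laurent).coeff m =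
      f.1.coeff (m + n • μ l) := by
    intro m
    rw [AddMonoidAlgebra.coeff_mul_single_eq_coeff_mul (m + n • μ l), mul_one]
    intro m' _
    rw [← sub_eq_add_neg, sub_eq_iff_eq_add]
  have hpn : pair (ρ l) (n • μ l) = n := by rw [pair_nsmul, h.pair_eq, if_pos rfl, mul_one]
  refine ⟨n, ⟨f.1 * AddMonoidAlgebra.single (-(n • μ l)) 1, ?_⟩, ?_, ?_, ?_⟩
  · intro m hm
    rw [Finsupp.mem_support_iff, hsupp, ← Finsupp.mem_support_iff] at hm
    have hM := sub_mem (f.2 _ hm).1 (nsmul_mem (h.mem l) n)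
    rw [add_sub_cancel_right] at hM
    refine ⟨hM, ?_⟩
    rintro v rfl
    have := hmin _ hm
    rw [pair_add, hpn, hk] at this
    linarith
  · intro hmem
    have := hmem (m₀ - n • μ l) (by
      rw [Finsupp.mem_support_iff, hsupp, sub_add_cancel, ← Finsupp.mem_support_iff]; exact hm₀)
    rw [sub_eq_add_neg, pair_add, pair_neg, hpn, hk] at this
    simp at this
  · apply Subtype.ext
    rw [chi_pow]
    change f.1 = AddMonoidAlgebra.single (n • μ l) 1 * (f.1 * AddMonoidAlgebra.single _ 1)
    rw [mul_left_comm, AddMonoidAlgebra.single_mul_single, add_neg_cancel, one_mul]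
    exact (mul_one _).symm
  · refine ⟨⟨m₀, hm₀, hk⟩, ?_⟩
    rintro _ ⟨m, hm, rfl⟩
    rw [← hk]
    exact hmin m hm

end IsDualBasis

/-! ### The invariant ring as the chart ring of the positive octant -/

/-- The rays of the positive octant. -/
def octant : Set (Fin 3 → ℚ) := Set.range fun k : Fin 3 => (Pi.single k 1 : Fin 3 → ℚ)

lemma pair_single (k : Fin 3) (m : Fin 3 → ℤ) : pair (Pi.single k 1) m = m k := by
  rw [pair, Finset.sum_eq_single k] <;> simp +contextual

lemma toLaurent_coeff (f : MvPolynomial (Fin 3) ℂ) (m : Fin 3 →₀ ℕ) :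
    (toLaurent f).coeff (fun i => (m i : ℤ)) = f.coeff m := by
  classical
  induction f using MvPolynomial.induction_on' with
  | monomial n c =>
    rw [toLaurent_monomial, MvPolynomial.coeff_monomial, AddMonoidAlgebra.coeff_single, Finsupp.single_apply]
    refine if_congr ?_ rfl rfl
    constructor
    · intro h
      ext i
      exact_mod_cast congrFun h i
    · rintro rfl; rfl
  | add p q hp hq =>
    rw [map_add, AddMonoidAlgebra.coeff_add, Finsupp.add_apply, hp, hq, MvPolynomial.coeff_add]

lemma toLaurent_injective : Function.Injective toLaurent := fun f g h => by
  ext m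
  rw [← toLaurent_coeff, ← toLaurent_coeff, h]

lemma exists_of_mem_support_toLaurent {f : MvPolynomial (Fin 3) ℂ} {m : Fin 3 → ℤ}
    (hm : m ∈ (toLaurent f).coeff.support) : ∃ n ∈ f.support, m = fun i => (n i : ℤ) := by
  classical
  rw [f.as_sum, map_sum, AddMonoidAlgebra.coeff_sum] at hm
  obtain ⟨n, hn, hmn⟩ := Finset.mem_biUnion.1 (Finsupp.support_finsetSum hm)
  rw [toLaurent_monomial, AddMonoidAlgebra.coeff_single] at hmn
  exact ⟨n, hn, Finset.mem_singleton.1 (Finsupp.support_single_subset hmn)⟩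

lemma support_toLaurent (f : MvPolynomial (Fin 3) ℂ) :
    ((toLaurent f).coeff.support : Set (Fin 3 → ℤ)) =
      (fun (n : Fin 3 →₀ ℕ) i => (n i : ℤ)) '' (f.support : Set (Fin 3 →₀ ℕ)) := by
  ext m
  constructor
  · intro hm
    obtain ⟨n, hn, rfl⟩ := exists_of_mem_support_toLaurent hm
    exact ⟨n, hn, rfl⟩
  · rintro ⟨n, hn, rfl⟩
    rw [Finset.mem_coe, Finsupp.mem_support_iff, toLaurent_coeff]
    exact MvPolynomial.mem_support_iff.1 hn

lemma toLaurent_mem_octant {r a : ℕ} [IsTerminalType r a] (f : invariants r a) :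
    toLaurent f.1 ∈ chartRing r a octant := by
  intro m hm
  obtain ⟨n, hn, rfl⟩ := exists_of_mem_support_toLaurent hm
  refine ⟨mem_invariants.1 f.2 n hn, ?_⟩
  rintro _ ⟨k, rfl⟩
  rw [pair_single]
  positivity

/-- The inclusion of the invariant polynomials into the chart ring of the octant. -/
def toOctant (r a : ℕ) [IsTerminalType r a] : invariants r a →ₐ[ℂ] chartRing r a octant :=
  (toLaurent.comp (invariants r a).val).codRestrict _ toLaurent_mem_octant

/-- Nonnegativity on the octant makes a Laurent monomial a polynomial one, and membership of its
exponent in M is invariance. -/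
lemma toOctant_bijective (r a : ℕ) [IsTerminalType r a] : Function.Bijective (toOctant r a) := by
  constructor
  · intro f g h
    exact Subtype.ext (toLaurent_injective (congrArg Subtype.val h))
  · intro f
    rw [← AlgHom.mem_range, eq_sum_chi f]
    refine sum_mem fun m _ => Subalgebra.smul_mem _ ?_ _
    have hm := f.2 m.1 m.2
    have h0 : ∀ k, 0 ≤ m.1 k := fun k => by
      have := hm.2 _ ⟨k, rfl⟩
      rw [pair_single] at this
      exact_mod_cast this
    let n : Fin 3 →₀ ℕ := Finsupp.equivFunOnFinite.symm fun k => (m.1 k).toNat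
    have hn : (fun i => (n i : ℤ)) = m.1 := funext fun k => Int.toNat_of_nonneg (h0 k)
    have hinv : MvPolynomial.monomial n (1 : ℂ) ∈ invariants r a := by
      rw [mem_invariants]
      intro n' hn'
      have : n' = n := Finset.mem_singleton.1 (MvPolynomial.support_monomial_subset hn')
      subst this
      have h1 : (r : ℤ) ∣ ∑ i, weight a i * m.1 i := hm.1
      rwa [← hn] at h1
    refine ⟨⟨_, hinv⟩, Subtype.ext ?_⟩
    change toLaurent (MvPolynomial.monomial n 1) = AddMonoidAlgebra.single m.1 1
    rw [toLaurent_monomial, hn]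

/-- The invariant ring is the chart ring of the octant. -/
def octantEquiv (r a : ℕ) [IsTerminalType r a] : invariants r a ≃ₐ[ℂ] chartRing r a octant :=
  AlgEquiv.ofBijective (toOctant r a) (toOctant_bijective r a)

/-- For a face of the octant, the inclusion of invariants is a localization map of the octant ring;
hence the chart of Y is also an open part of X. -/
lemma toChart_eq {r a : ℕ} [IsTerminalType r a] (τ : Fan r a) (hτ : τ.1 ⊆ octant) :
    (toChart r a τ).toRingHom = (faceHom hτ).comp (octantEquiv r a).toRingEquiv.toRingHom := rfl


/-! ### The order along a principal prime -/

/-- In the localization at a principal prime `(t)`, the order of `t ^ n * g` is `n` if `t` does not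
divide `g`. -/
lemma ord_pow_mul {A S : Type*} [CommRing A] [CommRing S] [IsDomain S] [Algebra A S] {P : Ideal A}
    [P.IsPrime] [IsLocalization.AtPrime S P] {t : A} (hP : P = Ideal.span {t})
    (ht : algebraMap A S t ≠ 0) (n : ℕ) {g : A} (hg : g ∉ P) :
    Ring.ord S (algebraMap A S (t ^ n * g)) = n := by
  have hu : IsUnit (algebraMap A S g) := IsLocalization.map_units S (⟨g, hg⟩ : P.primeCompl)
  have hloc : IsLocalRing S := IsLocalization.AtPrime.isLocalRing S P
  have hmax : Ideal.span {algebraMap A S t} = IsLocalRing.maximalIdeal S := by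
    rw [← IsLocalization.AtPrime.map_eq_maximalIdeal P S, hP, Ideal.map_span, Set.image_singleton]
  -- The quotient of `S` by t is the residue field, a module of length one.
  have h1 : Ring.ord S (algebraMap A S t) = 1 := by
    rw [Ring.ord, Module.length_eq_one_iff, hmax,
      isSimpleModule_iff_isSimpleModule_of_algebraMap_surjective
        (S := S ⧸ IsLocalRing.maximalIdeal S) Ideal.Quotient.mk_surjective]
    let := Ideal.Quotient.field (IsLocalRing.maximalIdeal S)
    exact instIsSimpleModule _
  rw [map_mul, map_pow, Ring.ord_mul_of_isUnit_right hu, Ring.ord_pow (by simpa using ht), h1]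
  simp

/-! ### Three-forms -/

section wedge
variable {K : Type} [Field K] [Algebra ℂ K]

/-- An alternating map is determined by its values on permutations of a basis, and both sides take
the same value there. -/
lemma wedge_eq_det_smul (e : Module.Basis (Fin 3) K Ω[K⁄ℂ]) {t : Fin 3 → K}
    (ht : ∀ l, e l = KaehlerDifferential.D ℂ K (t l)) (c : Fin 3 → K) :
    wedge c = e.det (fun i => KaehlerDifferential.D ℂ K (c i)) • wedge t := by
  have : exteriorPower.ιMulti K 3 (M := Ω[K⁄ℂ]) =
      (LinearMap.toSpanSingleton K _ (wedge t)).compAlternatingMap e.det := by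
    refine Module.Basis.ext_alternating e fun i h => ?_
    let σ : Equiv.Perm (Fin 3) := Equiv.ofBijective i (Finite.injective_iff_bijective.1 h)
    change exteriorPower.ιMulti K 3 (e ∘ σ) =
      ((LinearMap.toSpanSingleton K _ (wedge t)).compAlternatingMap e.det) (e ∘ σ)
    rw [AlternatingMap.map_perm, AlternatingMap.map_perm]
    congr 1
    simp only [LinearMap.compAlternatingMap_apply, e.det_self, LinearMap.toSpanSingleton_apply,
      one_smul, wedge]
    congr 1
    exact funext ht
  exact congrArg (fun f => f fun i => KaehlerDifferential.D ℂ K (c i)) this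

/-- The determinant in the basis `e` factors through the exterior power and takes the value 1 on
this wedge. -/
lemma wedge_ne_zero (e : Module.Basis (Fin 3) K Ω[K⁄ℂ]) {t : Fin 3 → K}
    (ht : ∀ l, e l = KaehlerDifferential.D ℂ K (t l)) : wedge t ≠ 0 := by
  intro h
  have h1 := exteriorPower.alternatingMapLinearEquiv_apply_ιMulti e.det
    (fun i => KaehlerDifferential.D ℂ K (t i))
  rw [wedge] at h
  rw [h, map_zero] at h1
  have : (fun i => KaehlerDifferential.D ℂ K (t i)) = e := funext fun i => (ht i).symm
  rw [this, e.det_self] at h1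
  exact zero_ne_one h1

/-- If `K` is the field of rational functions in `t`, the differentials `d tₗ` form a basis. -/
lemma exists_basis_differentials {t : Fin 3 → K}
    (hinj : Function.Injective (MvPolynomial.aeval (R := ℂ) t))
    (hsurj : ∀ z : K, ∃ x y : MvPolynomial (Fin 3) ℂ,
      z = MvPolynomial.aeval t x / MvPolynomial.aeval t y) :
    ∃ e : Module.Basis (Fin 3) K Ω[K⁄ℂ], ∀ l, e l = KaehlerDifferential.D ℂ K (t l) := by
  let _ : Algebra (MvPolynomial (Fin 3) ℂ) K := (MvPolynomial.aeval (R := ℂ) t).toRingHom.toAlgebra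
  have hmap : ∀ x, algebraMap (MvPolynomial (Fin 3) ℂ) K x = MvPolynomial.aeval t x := fun _ => rfl
  have : IsScalarTower ℂ (MvPolynomial (Fin 3) ℂ) K :=
    IsScalarTower.of_algebraMap_eq fun c => by
      rw [hmap, MvPolynomial.algebraMap_eq, MvPolynomial.aeval_C]
  have : FaithfulSMul (MvPolynomial (Fin 3) ℂ) K :=
    (faithfulSMul_iff_algebraMap_injective _ _).2 hinj
  have : IsFractionRing (MvPolynomial (Fin 3) ℂ) K := IsFractionRing.of_field _ _ hsurj
  -- Kähler differentials commute with localization, so the basis of the polynomial ring passes to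
  -- its fraction field.
  refine ⟨(KaehlerDifferential.mvPolynomialBasis ℂ (Fin 3)).ofIsLocalizedModule K
    (nonZeroDivisors (MvPolynomial (Fin 3) ℂ))
    (KaehlerDifferential.map ℂ ℂ (MvPolynomial (Fin 3) ℂ) K), fun l => ?_⟩
  rw [Module.Basis.ofIsLocalizedModule_apply, KaehlerDifferential.mvPolynomialBasis_apply,
    KaehlerDifferential.map_D, hmap, MvPolynomial.aeval_X]

end wedge

/-! ### Coordinates on a chart -/

namespace IsDualBasis
variable {r a : ℕ} {ρ : Fin 3 → Fin 3 → ℚ} {μ : Fin 3 → Fin 3 → ℤ} (h : IsDualBasis r a ρ μ)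
  {τ : Set (Fin 3 → ℚ)} (hτ : τ ⊆ Set.range ρ)
  {K : Type} [Field K] [Algebra ℂ K] (κ : chartRing r a τ →ₐ[ℂ] K)

/-- The coordinate functions of a chart. -/
def coord (l : Fin 3) : K := κ (chi (μ l) (h.mem_dualMonoid hτ l))

include h in
lemma pair_sum (k : Fin 3 → ℤ) (i : Fin 3) : pair (ρ i) (∑ l, k l • μ l) = k i := by
  rw [Fin.sum_univ_three, pair_add, pair_add, pair_zsmul, pair_zsmul, pair_zsmul, h.pair_eq,
    h.pair_eq, h.pair_eq]
  fin_cases i <;> simp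

include h in
lemma nat_sum_mem (hτ : τ ⊆ Set.range ρ) (n : Fin 3 → ℕ) :
    ∑ l, n l • μ l ∈ dualMonoid r a τ :=
  sum_mem fun l _ => nsmul_mem (h.mem_dualMonoid hτ l) _

lemma map_chi_nat (n : Fin 3 → ℕ) :
    κ (chi (∑ l, n l • μ l) (h.nat_sum_mem hτ n)) = ∏ l, h.coord hτ κ l ^ n l := by
  simp only [coord, ← map_pow, ← map_prod, chi_pow]
  congr 1
  simp only [Fin.prod_univ_three, chi_mul]
  exact chi_congr (Fin.sum_univ_three _) _ _

lemma coord_ne_zero (hκ : Function.Injective κ) (l : Fin 3) : h.coord hτ κ l ≠ 0 := by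
  rw [coord, map_ne_zero_iff _ hκ]
  exact chi_ne_zero _

/-- Coordinates whose ray is not in `τ` may have negative exponents. The negative part is moved to
the other side, where all exponents are natural numbers and the identity holds in the chart ring. -/
lemma map_chi (hκ : Function.Injective κ) {m : Fin 3 → ℤ} (hm : m ∈ dualMonoid r a τ)
    {k : Fin 3 → ℤ} (hk : m = ∑ l, k l • μ l) :
    κ (chi m hm) = ∏ l, h.coord hτ κ l ^ k l := by
  have h0 := h.coord_ne_zero hτ κ hκ
  have h1 := h.map_chi_nat hτ κ fun l => (k l).toNat
  have h2 := h.map_chi_nat hτ κ fun l => (-k l).toNat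
  have h3 : κ (chi m hm) * ∏ l, h.coord hτ κ l ^ (-k l).toNat =
      ∏ l, h.coord hτ κ l ^ (k l).toNat := by
    rw [← h1, ← h2, ← map_mul, chi_mul]
    congr 1
    refine chi_congr ?_ _ _
    rw [hk, ← Finset.sum_add_distrib]
    refine Finset.sum_congr rfl fun l _ => ?_
    rw [← natCast_zsmul, ← natCast_zsmul, ← add_zsmul]
    congr 1
    omega
  have h4 : ∏ l, h.coord hτ κ l ^ (-k l).toNat ≠ 0 :=
    Finset.prod_ne_zero_iff.2 fun l _ => pow_ne_zero _ (h0 l)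
  rw [← mul_left_inj' h4, h3, ← Finset.prod_mul_distrib]
  refine Finset.prod_congr rfl fun l _ => ?_
  rw [← zpow_natCast, ← zpow_natCast, ← zpow_add₀ (h0 l)]
  congr 1
  omega

/-- Pairing with `ρ` recovers the exponents n from Σ n_l μ_l, so distinct monomials in the
coordinates go to distinct characters, which are linearly independent. -/
lemma aeval_coord_injective (hκ : Function.Injective κ) :
    Function.Injective (MvPolynomial.aeval (R := ℂ) (h.coord hτ κ)) := by
  let φ : MvPolynomial (Fin 3) ℂ →ₐ[ℂ] chartRing r a τ :=
    MvPolynomial.aeval fun l => chi (μ l) (h.mem_dualMonoid hτ l)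
  have hφ : MvPolynomial.aeval (R := ℂ) (h.coord hτ κ) = κ.comp φ := by
    apply MvPolynomial.algHom_ext
    intro l
    simp [φ, coord]
  have hmon : ∀ (n : Fin 3 →₀ ℕ) (c : ℂ), φ (MvPolynomial.monomial n c) =
      c • chi (∑ l, n l • μ l) (h.nat_sum_mem hτ n) := by
    intro n c
    rw [MvPolynomial.aeval_monomial, Finsupp.prod_fintype _ _ (by simp), Algebra.smul_def]
    congr 1
    simp only [chi_pow, Fin.prod_univ_three, chi_mul]
    exact chi_congr (Fin.sum_univ_three fun l => n l • μ l).symm _ _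
  have hcoeff : ∀ (f : MvPolynomial (Fin 3) ℂ) (n : Fin 3 →₀ ℕ),
      (φ f).1.coeff (∑ l, n l • μ l) = f.coeff n := by
    classical
    intro f n
    induction f using MvPolynomial.induction_on' with
    | monomial n' c =>
      rw [hmon, MvPolynomial.coeff_monomial]
      change c • (Finsupp.single (∑ l, n' l • μ l) (1 : ℂ)) (∑ l, n l • μ l) = _
      have : (∑ l, n' l • μ l = ∑ l, n l • μ l) ↔ n' = n := by
        refine ⟨fun he => ?_, fun he => by rw [he]⟩
        ext i
        have h1 := h.pair_sum (fun l => n' l) i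
        have h2 := h.pair_sum (fun l => n l) i
        simp only [natCast_zsmul] at h1 h2
        rw [he, h2] at h1
        exact_mod_cast h1.symm
      rw [Finsupp.single_apply, if_congr this rfl rfl]
      simp
    | add p q hp hq =>
      rw [map_add, MvPolynomial.coeff_add, ← hp, ← hq]
      rfl
  rw [hφ]
  refine hκ.comp fun f g hfg => ?_
  ext n
  have hfg' : φ f = φ g := hfg
  rw [← hcoeff, ← hcoeff, hfg']

/-- Elements of the chart ring are Laurent polynomials in the coordinates, so the subfield generated
by the coordinates contains them and all their quotients. -/
lemma exists_eq_aeval_div (hκ : Function.Injective κ)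
    (hsurj : ∀ z : K, ∃ x y : chartRing r a τ, z = κ x / κ y) (z : K) :
    ∃ x y : MvPolynomial (Fin 3) ℂ, z = MvPolynomial.aeval (h.coord hτ κ) x /
      MvPolynomial.aeval (h.coord hτ κ) y := by
  have hinj := h.aeval_coord_injective hτ κ hκ
  let F : Subfield K := (IsFractionRing.lift (A := MvPolynomial (Fin 3) ℂ)
    (K := FractionRing (MvPolynomial (Fin 3) ℂ))
    (g := (MvPolynomial.aeval (R := ℂ) (h.coord hτ κ)).toRingHom) hinj).fieldRange
  have hF : ∀ x, MvPolynomial.aeval (R := ℂ) (h.coord hτ κ) x ∈ F := fun x =>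
    ⟨algebraMap _ _ x, IsFractionRing.lift_algebraMap hinj x⟩
  have hchart : ∀ f : chartRing r a τ, κ f ∈ F := by
    intro f
    rw [eq_sum_chi f, map_sum]
    refine sum_mem fun m _ => ?_
    rw [map_smul, Algebra.smul_def]
    refine mul_mem ?_ ?_
    · simpa using hF (MvPolynomial.C (f.1.coeff m.1))
    · obtain ⟨k, -, hk⟩ := h.span m.1 (f.2 m.1 m.2).1
      rw [h.map_chi hτ κ hκ _ hk]
      refine prod_mem fun l _ => zpow_mem ?_ _
      simpa using hF (MvPolynomial.X l)
  obtain ⟨x, y, rfl⟩ := hsurj z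
  obtain ⟨w, hw⟩ := div_mem (hchart x) (hchart y)
  obtain ⟨u, v, -, rfl⟩ := IsFractionRing.div_surjective (A := MvPolynomial (Fin 3) ℂ) w
  refine ⟨u, v, ?_⟩
  rw [← hw, map_div₀, IsFractionRing.lift_algebraMap, IsFractionRing.lift_algebraMap]
  rfl

lemma exists_basis (hκ : Function.Injective κ)
    (hsurj : ∀ z : K, ∃ x y : chartRing r a τ, z = κ x / κ y) :
    ∃ e : Module.Basis (Fin 3) K Ω[K⁄ℂ],
      ∀ l, e l = KaehlerDifferential.D ℂ K (h.coord hτ κ l) :=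
  exists_basis_differentials (h.aeval_coord_injective hτ κ hκ)
    (h.exists_eq_aeval_div hτ κ hκ hsurj)

variable (e : Module.Basis (Fin 3) K Ω[K⁄ℂ])
  (he : ∀ l, e l = KaehlerDifferential.D ℂ K (h.coord hτ κ l))
include he

/-- The partial derivatives of a monomial. -/
lemma repr_D_chi (hκ : Function.Injective κ) {m : Fin 3 → ℤ} (hm : m ∈ dualMonoid r a τ)
    {k : Fin 3 → ℤ} (hk : m = ∑ l, k l • μ l) (l : Fin 3) :
    e.repr (KaehlerDifferential.D ℂ K (κ (chi m hm))) l =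
      k l * κ (chi m hm) / h.coord hτ κ l := by
  have h0 := h.coord_ne_zero hτ κ hκ
  have hD : KaehlerDifferential.D ℂ K (κ (chi m hm)) =
      ∑ l, (k l * κ (chi m hm) / h.coord hτ κ l) • e l := by
    simp only [he, h.map_chi hτ κ hκ hm hk, Fin.sum_univ_three, Fin.prod_univ_three,
      Derivation.leibniz, Derivation.leibniz_zpow]
    simp only [zpow_sub_one₀ (h0 _), ← Int.cast_smul_eq_zsmul K, smul_smul, smul_add]
    rw [add_comm, add_comm (_ • KaehlerDifferential.D ℂ K (h.coord hτ κ 1))]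
    congr 1
    · congr 2 <;> ring
    · congr 1; ring
  rw [hD, map_sum, Finsupp.finsetSum_apply]
  simp [Finsupp.single_apply]

/-- The partial derivatives preserve every localization of the chart ring at a prime. -/
lemma repr_D_mem (hκ : Function.Injective κ) {S : Type*} [CommRing S] [Algebra S K]
    [Algebra (chartRing r a τ) S] {P : Ideal (chartRing r a τ)} [P.IsPrime]
    [IsLocalization.AtPrime S P]
    (hS : ∀ f, algebraMap S K (algebraMap (chartRing r a τ) S f) = κ f) (c : S) (l : Fin 3) :
    e.repr (KaehlerDifferential.D ℂ K (algebraMap S K c)) l ∈ (algebraMap S K).range := by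
  let δ : Derivation ℂ K K := (e.coord l).compDer (KaehlerDifferential.D ℂ K)
  have h0 := h.coord_ne_zero hτ κ hκ
  have hδ : ∀ x, δ x = e.repr (KaehlerDifferential.D ℂ K x) l := fun _ => rfl
  rw [← hδ]
  have hchart : ∀ f : chartRing r a τ, δ (κ f) ∈ (algebraMap S K).range := by
    intro f
    rw [eq_sum_chi f, map_sum, map_sum]
    refine sum_mem fun m _ => ?_
    rw [map_smul, Derivation.map_smul, Algebra.smul_def]
    refine mul_mem ⟨algebraMap _ _ (algebraMap ℂ (chartRing r a τ) (f.1.coeff m.1)), ?_⟩ ?_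
    · rw [hS, AlgHom.commutes]
    · have hm := f.2 m.1 m.2
      obtain ⟨k, hk, hk'⟩ := h.span m.1 hm.1
      rw [hδ, h.repr_D_chi hτ κ e he hκ hm hk']
      by_cases hkl : k l = 0
      · rw [hkl]; simp
      -- Only the ray `ρ l` could obstruct. If it lies in `τ`, then k_l ≥ 0, and k_l ≠ 0 leaves room
      -- to subtract `μ l`; so the partial derivative stays in the chart ring.
      · have hsub : m.1 - μ l ∈ dualMonoid r a τ := by
          refine ⟨sub_mem hm.1 (h.mem l), fun v hv => ?_⟩
          obtain ⟨i, rfl⟩ := hτ hv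
          have hnn := hm.2 _ hv
          rw [sub_eq_add_neg, pair_add, pair_neg, h.pair_eq]
          rw [hk] at hnn ⊢
          split_ifs with hil
          · subst hil
            have : 0 ≤ k i := by exact_mod_cast hnn
            have : (1 : ℚ) ≤ k i := by exact_mod_cast (by omega : 1 ≤ k i)
            linarith
          · simpa using hnn
        have hmul : κ (chi m.1 hm) = κ (chi (m.1 - μ l) hsub) * h.coord hτ κ l := by
          rw [coord, ← map_mul, chi_mul]
          congr 1
          exact chi_congr (by simp) _ _
        rw [hmul, mul_div_assoc, mul_div_cancel_right₀ _ (h0 l), ← hS]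
        exact mul_mem (intCast_mem _ _) ⟨_, rfl⟩
  obtain ⟨f, g, rfl⟩ := IsLocalization.exists_mk'_eq P.primeCompl c
  have hu := IsLocalization.map_units S g
  have hspec : algebraMap S K (IsLocalization.mk' S f g) * κ g.1 = κ f := by
    rw [← hS, ← hS, ← map_mul, IsLocalization.mk'_spec]
  have hg0 : κ g.1 ≠ 0 := by
    rw [← hS]
    exact (hu.map (algebraMap S K)).ne_zero
  obtain ⟨w, hw⟩ := hu.exists_right_inv
  have hinv : (κ g.1)⁻¹ = algebraMap S K w := by
    refine inv_eq_of_mul_eq_one_right ?_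
    rw [← hS, ← map_mul, hw, map_one]
  rw [← eq_div_iff hg0] at hspec
  -- The quotient rule extends the claim from the chart ring to its localization, where the
  -- denominator is a unit.
  rw [hspec, Derivation.leibniz_div, smul_eq_mul, smul_eq_mul, smul_eq_mul, hinv]
  refine mul_mem (pow_mem (RingHom.mem_range_self _ _) 2) (sub_mem (mul_mem ?_ (hchart f)) (mul_mem ?_ (hchart _)))
  · rw [← hS]; exact ⟨_, rfl⟩
  · rw [← hS]; exact ⟨_, rfl⟩

/-- The form `dt₀ ∧ dt₁ ∧ dt₂` generates the three-forms of every localization of the chart ring. -/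
lemma exists_wedge_eq_smul (hκ : Function.Injective κ) {S : Type*} [CommRing S] [Algebra S K]
    [Algebra (chartRing r a τ) S] {P : Ideal (chartRing r a τ)} [P.IsPrime]
    [IsLocalization.AtPrime S P]
    (hS : ∀ f, algebraMap S K (algebraMap (chartRing r a τ) S f) = κ f) (c : Fin 3 → S) :
    ∃ s : S, wedge (fun i => algebraMap S K (c i)) =
      algebraMap S K s • wedge (h.coord hτ κ) := by
  choose B hB using fun l i => h.repr_D_mem hτ κ e he hκ (P := P) hS (c i) l
  refine ⟨(Matrix.of B).det, ?_⟩
  rw [wedge_eq_det_smul e he]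
  congr 1
  rw [Module.Basis.det_apply, RingHom.map_det]
  congr 1
  ext l i
  exact (hB l i).symm

/-- A wedge of differentials of monomials in terms of the coordinates. -/
lemma wedge_chi (hκ : Function.Injective κ) {m : Fin 3 → Fin 3 → ℤ}
    (hm : ∀ j, m j ∈ dualMonoid r a τ) {k : Fin 3 → Fin 3 → ℤ}
    (hk : ∀ j, m j = ∑ l, k j l • μ l) :
    wedge (fun j => κ (chi (m j) (hm j))) =
      (((Matrix.of k).det : K) * (∏ j, κ (chi (m j) (hm j))) / ∏ l, h.coord hτ κ l) •
        wedge (h.coord hτ κ) := by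
  have h0 := h.coord_ne_zero hτ κ hκ
  rw [wedge_eq_det_smul e he]
  congr 1
  -- Logarithmic differentiation: up to scaling the columns by the monomials and the rows by the
  -- inverse coordinates, the Jacobian matrix is the integer matrix of exponents.
  have : e.toMatrix (fun i => KaehlerDifferential.D ℂ K (κ (chi (m i) (hm i)))) =
      Matrix.of fun l j => k j l * κ (chi (m j) (hm j)) / h.coord hτ κ l := by
    ext l j
    rw [Module.Basis.toMatrix_apply, h.repr_D_chi hτ κ e he hκ (hm j) (hk j)]
    rfl
  rw [Module.Basis.det_apply, this, Matrix.det_fin_three, Matrix.det_fin_three,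
    Fin.prod_univ_three, Fin.prod_univ_three]
  simp only [Matrix.of_apply]
  push_cast
  field_simp [h0 0, h0 1, h0 2]
  ring

end IsDualBasis

lemma IsDualBasis.det_ne_zero {r a : ℕ} {ρ : Fin 3 → Fin 3 → ℚ} {μ : Fin 3 → Fin 3 → ℤ}
    (h : IsDualBasis r a ρ μ) : (Matrix.of ρ).det ≠ 0 := by
  have : Matrix.of ρ * (Matrix.of fun j i => (μ j i : ℚ)).transpose = 1 := by
    ext i j
    rw [Matrix.mul_apply, Matrix.one_apply, ← h.pair_eq i j]
    rfl
  exact Matrix.det_ne_zero_of_right_inverse this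


/-! ### Local rings of an affine chart of a scheme -/

/-- The prime ideal of a point of an affine scheme. -/
def pointIdeal {A : Type} [CommRing A] (p : Spec (CommRingCat.of A)) : Ideal A :=
  PrimeSpectrum.asIdeal (R := A) p

instance {A : Type} [CommRing A] (p : Spec (CommRingCat.of A)) : (pointIdeal p).IsPrime :=
  PrimeSpectrum.isPrime (R := A) p

section chart
variable {Z : Scheme.{0}} {A : Type} [CommRing A] (j : Spec (CommRingCat.of A) ⟶ Z)
  [IsOpenImmersion j] (p : Spec (CommRingCat.of A))

/-- The map from the coordinate ring of a chart to a local ring. -/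
def chartStalk : A →+* Z.presheaf.stalk (j p) :=
  (inv (j.stalkMap p)).hom.comp (StructureSheaf.toStalk A p).hom

lemma stalkMap_chartStalk (f : A) :
    (j.stalkMap p).hom (chartStalk j p f) = (StructureSheaf.toStalk A p).hom f := by
  change (inv (j.stalkMap p) ≫ j.stalkMap p).hom _ = _
  rw [IsIso.inv_hom_id]
  rfl

lemma isLocalization_chartStalk :
    letI := (chartStalk j p).toAlgebra
    IsLocalization.AtPrime (Z.presheaf.stalk (j p)) (pointIdeal p) := by
  let _ := (chartStalk j p).toAlgebra
  let _ : Algebra A ((Spec (CommRingCat.of A)).presheaf.stalk p) :=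
    StructureSheaf.stalkAlgebra A p
  have : IsLocalization.AtPrime ((Spec (CommRingCat.of A)).presheaf.stalk p) (pointIdeal p) :=
    StructureSheaf.IsLocalization.to_stalk A p
  let E : (Spec (CommRingCat.of A)).presheaf.stalk p ≃+* Z.presheaf.stalk (j p) :=
    (asIso (j.stalkMap p)).symm.commRingCatIsoToRingEquiv
  exact IsLocalization.isLocalization_of_algEquiv (pointIdeal p).primeCompl
    (AlgEquiv.ofRingEquiv (f := E) fun _ => rfl)

/-- The germ of a global section in terms of its restriction to a chart. -/
lemma germ_eq_chartStalk {s : Γ(Z, ⊤)} {f : A}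
    (h : j.appTop s = (Scheme.ΓSpecIso (CommRingCat.of A)).inv f) :
    Z.presheaf.germ ⊤ (j p) trivial s = chartStalk j p f := by
  have hinj : Function.Injective (j.stalkMap p).hom :=
    ((ConcreteCategory.isIso_iff_bijective (j.stalkMap p)).1 inferInstance).1
  apply hinj
  rw [stalkMap_chartStalk]
  refine (Scheme.Hom.germ_stalkMap_apply j ⊤ p trivial s).trans ?_
  have : j.app ⊤ s = (Scheme.ΓSpecIso (CommRingCat.of A)).inv f := h
  rw [this]
  rfl

variable [IsIntegral Z]

/-- The map from the coordinate ring of a chart to the function field. -/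
def chartFun : A →+* Z.functionField :=
  (algebraMap (Z.presheaf.stalk (j p)) Z.functionField).comp (chartStalk j p)

/-- Computes the rational function of a global section in any chart and at any point of it;
constants, pullbacks and functions on X are all read off this way. -/
lemma germ_eq_chartFun {s : Γ(Z, ⊤)} {f : A}
    (h : j.appTop s = (Scheme.ΓSpecIso (CommRingCat.of A)).inv f) :
    Z.presheaf.germ ⊤ (genericPoint Z) trivial s = chartFun j p f := by
  have : Nonempty (⊤ : Z.Opens) := ⟨⟨j p, trivial⟩⟩
  rw [chartFun, RingHom.comp_apply, ← germ_eq_chartStalk j p h]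
  exact (Scheme.algebraMap_germ_eq_germToFunctionField (X := Z) (U := ⊤) trivial s).symm

omit [IsIntegral Z] in
lemma chartStalk_injective [IsDomain A] : Function.Injective (chartStalk j p) := by
  let _ := (chartStalk j p).toAlgebra
  have := isLocalization_chartStalk j p
  exact IsLocalization.injective (M := (pointIdeal p).primeCompl) (Z.presheaf.stalk (j p))
    (pointIdeal p).primeCompl_le_nonZeroDivisors

lemma chartFun_injective [IsDomain A] : Function.Injective (chartFun j p) :=
  (IsFractionRing.injective (Z.presheaf.stalk (j p)) Z.functionField).comp
    (chartStalk_injective j p)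

lemma exists_eq_chartFun_div [IsDomain A] (z : Z.functionField) :
    ∃ x y : A, z = chartFun j p x / chartFun j p y := by
  let _ := (chartStalk j p).toAlgebra
  have := isLocalization_chartStalk j p
  have key : ∀ s : Z.presheaf.stalk (j p), ∃ x y : A, chartFun j p y ≠ 0 ∧
      algebraMap (Z.presheaf.stalk (j p)) Z.functionField s =
        chartFun j p x / chartFun j p y := by
    intro s
    obtain ⟨f, g, rfl⟩ := IsLocalization.exists_mk'_eq (pointIdeal p).primeCompl s
    have hg : chartFun j p g.1 ≠ 0 := by
      rw [map_ne_zero_iff _ (chartFun_injective j p)]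
      exact fun h0 => g.2 (h0 ▸ zero_mem _)
    refine ⟨f, g.1, hg, ?_⟩
    rw [eq_div_iff hg]
    change algebraMap (Z.presheaf.stalk (j p)) Z.functionField _ *
      algebraMap (Z.presheaf.stalk (j p)) Z.functionField (algebraMap A _ g.1) = _
    rw [← map_mul, IsLocalization.mk'_spec]
    rfl
  obtain ⟨s, t, -, rfl⟩ := IsFractionRing.div_surjective (A := Z.presheaf.stalk (j p)) z
  obtain ⟨x, y, hy, hs⟩ := key s
  obtain ⟨x', y', hy', ht⟩ := key t
  exact ⟨x * y', y * x', by rw [hs, ht, map_mul, map_mul, div_div_div_eq]⟩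

variable [IsLocallyNoetherian Z]

lemma ord_algebraMap_of_isUnit {z : Z} {s : Z.presheaf.stalk z} (hs : IsUnit s) :
    Scheme.ord (algebraMap (Z.presheaf.stalk z) Z.functionField s) z = 0 := by
  by_cases hz : Order.coheight z = 1
  · have : Ring.KrullDimLE 1 (Z.presheaf.stalk z) := krullDimLE_of_coheight_le hz.le
    have h0 : algebraMap (Z.presheaf.stalk z) Z.functionField s ≠ 0 :=
      (hs.map (algebraMap (Z.presheaf.stalk z) Z.functionField)).ne_zero
    rw [Scheme.ord_eq_iff hz h0]
    exact Ring.ordFrac_of_isUnit hs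
  -- Outside codimension one the order takes its default value zero.
  · exact Scheme.ord_eq_zero_of_coheight_neq_one hz _

lemma ord_chartFun_of_isUnit {f : A} (hf : IsUnit f) :
    Scheme.ord (chartFun j p f) (j p) = 0 :=
  ord_algebraMap_of_isUnit (hf.map (chartStalk j p))

/-- The order at a principal prime of a chart. -/
lemma ord_chartFun_pow_mul [IsDomain A] (hz : Order.coheight (j p) = 1) {t : A}
    (hP : pointIdeal p = Ideal.span {t}) (ht : t ≠ 0) (n : ℕ) {g : A} (hg : g ∉ pointIdeal p) :
    Scheme.ord (chartFun j p (t ^ n * g)) (j p) = n := by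
  let _ := (chartStalk j p).toAlgebra
  have := isLocalization_chartStalk j p
  have : Ring.KrullDimLE 1 (Z.presheaf.stalk (j p)) := krullDimLE_of_coheight_le hz.le
  have hg0 : g ≠ 0 := fun h0 => hg (h0 ▸ zero_mem _)
  have hne : t ^ n * g ≠ 0 := mul_ne_zero (pow_ne_zero _ ht) hg0
  rw [Scheme.ord_eq_iff hz ((map_ne_zero_iff _ (chartFun_injective j p)).2 hne)]
  have hs : chartStalk j p (t ^ n * g) ≠ 0 :=
    (map_ne_zero_iff _ (chartStalk_injective j p)).2 hne
  refine (Ring.ordFrac_eq_ord (Z.presheaf.stalk (j p)) hs).trans ?_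
  refine Ring.ordMonoidWithZeroHom_eq_coe _ (mem_nonZeroDivisors_iff_ne_zero.2 hs) ?_
  exact ord_pow_mul (S := Z.presheaf.stalk (j p)) hP
    ((map_ne_zero_iff _ (chartStalk_injective j p)).2 ht) n hg

omit [IsIntegral Z] [IsLocallyNoetherian Z] in
lemma coheight_chart : Order.coheight (j p) = (pointIdeal p).height :=
  (coheight_eq_of_isOpenImmersion j).trans (idealHeight_eq_coheight (CommRingCat.of A) p).symm

end chart

/-- The upper bound is Krull's principal ideal theorem; the lower one holds because zero is a
smaller prime. -/
lemma height_eq_one_of_eq_span {A : Type*} [CommRing A] [IsDomain A] [IsNoetherianRing A]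
    {P : Ideal A} [P.IsPrime] {t : A} (hP : P = Ideal.span {t}) (ht : t ≠ 0) : P.height = 1 := by
  apply le_antisymm
  · have : (Ideal.span {t}).IsPrincipal := ⟨t, rfl⟩
    refine Ideal.height_le_one_of_isPrincipal_of_mem_minimalPrimes (Ideal.span {t}) P ?_
    rw [← hP, Ideal.minimalPrimes_eq_subsingleton_self]
    exact Set.mem_singleton _
  · have hbot : (⊥ : Ideal A) < P := by
      rw [bot_lt_iff_ne_bot, hP, Ne, Ideal.span_singleton_eq_bot]
      exact ht
    exact le_add_self.trans (Ideal.height_add_one_le_of_lt_of_isPrime hbot)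

/-! ### Forms on toric charts -/

section toricChart
variable {r a : ℕ} {τ : Set (Fin 3 → ℚ)} {Z : Scheme.{0}} [IsIntegral Z]
  (π : Z ⟶ Spec (CommRingCat.of ℂ)) (j : Spec (CommRingCat.of (chartRing r a τ)) ⟶ Z)
  [IsOpenImmersion j] (p : Spec (CommRingCat.of (chartRing r a τ)))

lemma scalars_eq_chartFun
    (hπ : j ≫ π = Spec.map (CommRingCat.ofHom (algebraMap ℂ (chartRing r a τ)))) (c : ℂ) :
    scalars π c = chartFun j p (algebraMap ℂ _ c) := by
  refine germ_eq_chartFun j p ?_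
  change (π.appTop ≫ j.appTop) _ = _
  rw [← Scheme.Hom.comp_appTop, hπ]
  exact ConcreteCategory.congr_hom (Scheme.ΓSpecIso_inv_naturality
    (CommRingCat.ofHom (algebraMap ℂ (chartRing r a τ)))).symm c

variable {π}

/-- The map from a toric chart ring to the function field, as a map of `ℂ`-algebras. -/
def chartAlgHom (hπ : j ≫ π = Spec.map (CommRingCat.ofHom (algebraMap ℂ (chartRing r a τ)))) :
    letI : Algebra ℂ Z.functionField := (scalars π).toAlgebra
    chartRing r a τ →ₐ[ℂ] Z.functionField :=
  letI : Algebra ℂ Z.functionField := (scalars π).toAlgebra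
  { chartFun j p with commutes' := fun c => (scalars_eq_chartFun π j p hπ c).symm }

/-- The exponent of `xₖ ^ r`. -/
lemma single_mem_dualMonoid (hpos : ∀ v ∈ τ, 0 ≤ v) (k : Fin 3) :
    (Pi.single k (r : ℤ) : Fin 3 → ℤ) ∈ dualMonoid r a τ := by
  constructor
  · change (r : ℤ) ∣ ∑ i, weight a i * _
    refine Finset.dvd_sum fun i _ => ?_
    by_cases h : i = k
    · subst h; simp
    · simp [h]
  · intro v hv
    refine Finset.sum_nonneg fun i _ => mul_nonneg (hpos v hv i) ?_
    by_cases h : i = k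
    · subst h; simp
    · simp [h]

lemma pair_single_right (v : Fin 3 → ℚ) (k : Fin 3) (n : ℤ) :
    pair v (Pi.single k n) = v k * n := by
  rw [pair, Finset.sum_eq_single k] <;> simp +contextual

lemma ord_prod_three {z : Z} [IsLocallyNoetherian Z] {f : Fin 3 → Z.functionField}
    (hf : ∀ i, f i ≠ 0) : Scheme.ord (∏ i, f i) z = ∑ i, Scheme.ord (f i) z := by
  rw [Fin.prod_univ_three, Fin.sum_univ_three, Scheme.ord_mul (mul_ne_zero (hf 0) (hf 1)) (hf 2),
    Scheme.ord_mul (hf 0) (hf 1)]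

lemma ord_one [IsLocallyNoetherian Z] (z : Z) : Scheme.ord (1 : Z.functionField) z = 0 := by
  have := Scheme.ord_mul (x := z) (one_ne_zero (α := Z.functionField)) one_ne_zero
  rw [mul_one] at this
  omega

lemma ord_pow [IsLocallyNoetherian Z] (z : Z) {f : Z.functionField} (hf : f ≠ 0) (n : ℕ) :
    Scheme.ord (f ^ n) z = n * Scheme.ord f z := by
  induction n with
  | zero => simp [ord_one]
  | succ n ih =>
    rw [pow_succ, Scheme.ord_mul (pow_ne_zero _ hf) hf, ih]
    push_cast
    ring

variable [IsLocallyNoetherian Z]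

/-- The order of `h (d(x ^ r) ∧ d(y ^ r) ∧ d(z ^ r))^{⊗ r}`, where `h = (xyz) ^ (-r (r - 1))`, at a
point where monomials have the order given by the vector `v`. -/
lemma hasPluriformOrder_chart (hr : 0 < r)
    (hπ : j ≫ π = Spec.map (CommRingCat.ofHom (algebraMap ℂ (chartRing r a τ))))
    {ρ : Fin 3 → Fin 3 → ℚ} {μ : Fin 3 → Fin 3 → ℤ} (hB : IsDualBasis r a ρ μ)
    (hτ : τ ⊆ Set.range ρ) (hpos : ∀ v ∈ τ, 0 ≤ v) {v : Fin 3 → ℚ} {ε : ℤ}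
    (hord : ∀ m (hm : m ∈ dualMonoid r a τ),
      (Scheme.ord (chartFun j p (chi m hm)) (j p) : ℚ) = pair v m)
    (hε : ∑ l, pair v (μ l) = ε) {b : Fin 3 → Z.functionField}
    (hb : ∀ k, b k = chartFun j p (chi _ (single_mem_dualMonoid hpos k)))
    {h : Z.functionField} (hh : h * (∏ k, b k) ^ (r - 1) = 1) {n : ℤ}
    (hn : (n : ℚ) = r * (∑ k, v k - ε)) :
    HasPluriformOrder π r h b (j p) n := by
  let _ : Algebra ℂ Z.functionField := (scalars π).toAlgebra
  let _ := (chartStalk j p).toAlgebra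
  have := isLocalization_chartStalk j p
  let κ : chartRing r a τ →ₐ[ℂ] Z.functionField := chartAlgHom j p hπ
  have hκ : Function.Injective κ := chartFun_injective j p
  obtain ⟨e, he⟩ := hB.exists_basis hτ κ hκ (exists_eq_chartFun_div j p)
  have h0 := hB.coord_ne_zero hτ κ hκ
  have hb0 : ∀ k, b k ≠ 0 := fun k => by
    rw [hb, map_ne_zero_iff _ (chartFun_injective j p)]
    exact chi_ne_zero _
  have hbprod : ∏ k, b k ≠ 0 := Finset.prod_ne_zero_iff.2 fun k _ => hb0 k
  have hh0 : h ≠ 0 := left_ne_zero_of_mul (hh.symm ▸ one_ne_zero)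
  choose k hk hk' using fun i => hB.span _ (single_mem_dualMonoid (a := a) hpos i).1
  -- The exponents of the x_k^r have coordinates `pair (ρ l) (r e_k)` = r ρ_l(k), so the matrix is r
  -- times the transpose of `ρ`, which is invertible by the existence of a dual basis.
  have hdet : (Matrix.of k).det ≠ 0 := by
    intro hd
    have h1 : (Matrix.of k).map (Int.cast : ℤ → ℚ) = (r : ℚ) • (Matrix.of ρ).transpose := by
      ext i l
      have := hk i l
      rw [pair_single_right] at this
      simp only [Matrix.map_apply, Matrix.of_apply, ← this, Matrix.smul_apply,
        Matrix.transpose_apply, smul_eq_mul]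
      push_cast
      ring
    have h2 := Int.cast_det (R := ℚ) (Matrix.of k)
    rw [hd, show (Matrix.of k).map (fun x => (x : ℚ)) = _ from h1, Matrix.det_smul, Matrix.det_transpose] at h2
    have hr' : (r : ℚ) ≠ 0 := by exact_mod_cast hr.ne'
    exact mul_ne_zero (pow_ne_zero _ hr') hB.det_ne_zero (h2.symm.trans Int.cast_zero)
  have hw := hB.wedge_chi hτ κ e he hκ (fun i => single_mem_dualMonoid hpos i) hk'
  have hbκ : (fun i => κ (chi _ (single_mem_dualMonoid hpos i))) = b :=
    funext fun i => (hb i).symm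
  rw [hbκ] at hw
  have hdetK : (((Matrix.of k).det : ℤ) : Z.functionField) =
      chartFun j p (algebraMap ℂ _ ((Matrix.of k).det : ℂ)) := by
    simp
  -- A nonzero integer is a unit in a ℂ-algebra, so the determinant does not affect the order.
  have hdetunit : IsUnit (algebraMap ℂ (chartRing r a τ) ((Matrix.of k).det : ℂ)) :=
    IsUnit.map _ (isUnit_iff_ne_zero.2 (by exact_mod_cast hdet))
  have hdet0 : (((Matrix.of k).det : ℤ) : Z.functionField) ≠ 0 := by
    rw [hdetK]
    exact (hdetunit.map (chartFun j p)).ne_zero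
  have hdetord : Scheme.ord (((Matrix.of k).det : ℤ) : Z.functionField) (j p) = 0 := by
    rw [hdetK]
    exact ord_chartFun_of_isUnit j p hdetunit
  have hcprod : ∏ l, hB.coord hτ κ l ≠ 0 := Finset.prod_ne_zero_iff.2 fun l _ => h0 l
  have hw0 := wedge_ne_zero e he
  set u : Z.functionField := ((Matrix.of k).det : Z.functionField) * (∏ j, b j) /
    ∏ l, hB.coord hτ κ l with hu
  have hu0 : u ≠ 0 := div_ne_zero (mul_ne_zero hdet0 hbprod) hcprod
  refine ⟨hh0, Scheme.ord u (j p), ⟨fun l => chartStalk j p (chi (μ l) (hB.mem_dualMonoid hτ l)),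
    fun c => ?_, u, hw, ?_, rfl⟩, ?_⟩
  · exact hB.exists_wedge_eq_smul hτ κ e he hκ (P := pointIdeal p) (fun _ => rfl) c
  · rw [hw]
    exact smul_ne_zero hu0 hw0
  -- Put S = Σ v_k. Then u has order rS - ε and h has order -(r - 1) r S, so the total order of h
  -- plus r times that of u is r (S - ε).
  · have hordu : Scheme.ord u (j p) + ∑ l, Scheme.ord (hB.coord hτ κ l) (j p) =
        ∑ i, Scheme.ord (b i) (j p) := by
      rw [← ord_prod_three h0, ← ord_prod_three hb0, ← Scheme.ord_mul hu0 hcprod, hu,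
        div_mul_cancel₀ _ hcprod, Scheme.ord_mul hdet0 hbprod, hdetord, zero_add]
    have hordh : Scheme.ord h (j p) + ((r - 1 : ℕ) : ℤ) * ∑ i, Scheme.ord (b i) (j p) = 0 := by
      rw [← ord_prod_three hb0, ← ord_pow _ hbprod, ← Scheme.ord_mul hh0 (pow_ne_zero _ hbprod), hh,
        ord_one]
    have hsb : ((∑ i, Scheme.ord (b i) (j p) : ℤ) : ℚ) = r * ∑ k, v k := by
      push_cast
      rw [Finset.mul_sum]
      refine Finset.sum_congr rfl fun i _ => ?_
      rw [hb, hord, pair_single_right]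
      push_cast
      ring
    have hsc : ((∑ l, Scheme.ord (hB.coord hτ κ l) (j p) : ℤ) : ℚ) = ε := by
      push_cast
      rw [← hε]
      exact Finset.sum_congr rfl fun l _ => hord _ _
    have h1 : ((r - 1 : ℕ) : ℚ) = r - 1 := by
      rw [Nat.cast_sub hr]; simp
    have e1 := congrArg (Int.cast : ℤ → ℚ) hordu
    have e2 := congrArg (Int.cast : ℤ → ℚ) hordh
    rw [Int.cast_add, hsc, hsb] at e1
    rw [Int.cast_add, Int.cast_mul, hsb, Int.cast_natCast, h1, Int.cast_zero] at e2
    have : (n : ℚ) = ((Scheme.ord h (j p) + r * Scheme.ord u (j p) : ℤ) : ℚ) := by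
      rw [hn]
      push_cast
      linear_combination -e2 - r * e1
    exact_mod_cast this

end toricChart


/-! ### The torus and the rays -/

lemma isUnit_chi_torus {r a : ℕ} {m : Fin 3 → ℤ} (hm : m ∈ dualMonoid r a ∅) :
    IsUnit (chi m hm) :=
  isUnit_chi hm ⟨neg_mem hm.1, by simp⟩

/-- The generic point of the divisor of a ray. -/
def rayPoint (r a : ℕ) (v : Fin 3 → ℚ) : Spec (CommRingCat.of (chartRing r a {v})) :=
  (⟨divisorIdeal r a (Set.mem_singleton v), inferInstance⟩ : PrimeSpectrum (chartRing r a {v}))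

lemma support_chi {r a : ℕ} {σ : Set (Fin 3 → ℚ)} {m : Fin 3 → ℤ} (hm : m ∈ dualMonoid r a σ) :
    (chi m hm).1.coeff.support = {m} := by
  change (Finsupp.single m (1 : ℂ)).support = _
  exact Finsupp.support_single (hb := one_ne_zero) ..

namespace IsDualBasis
variable {r a : ℕ} {ρ : Fin 3 → Fin 3 → ℚ} {μ : Fin 3 → Fin 3 → ℤ} (h : IsDualBasis r a ρ μ)
  (l : Fin 3) [IsNoetherianRing (chartRing r a {ρ l})]
  {Z : Scheme.{0}} (j : Spec (CommRingCat.of (chartRing r a {ρ l})) ⟶ Z) [IsOpenImmersion j]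
include h

lemma coheight_rayPoint : Order.coheight (j (rayPoint r a (ρ l))) = 1 :=
  (coheight_chart j _).trans (height_eq_one_of_eq_span (h.divisorIdeal_eq_span l) (chi_ne_zero _))

variable [IsIntegral Z] [IsLocallyNoetherian Z]

/-- The order along the divisor of a ray is the monomial valuation. -/
lemma isLeast_ord_rayPoint {f : chartRing r a {ρ l}} (hf : f ≠ 0) :
    IsLeast (pair (ρ l) '' f.1.coeff.support)
      (Scheme.ord (chartFun j (rayPoint r a (ρ l)) f) (j (rayPoint r a (ρ l))) : ℚ) := by
  obtain ⟨n, g, hg, hfg, hn⟩ := h.exists_eq_pow_mul l hf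
  have := ord_chartFun_pow_mul j (rayPoint r a (ρ l)) (h.coheight_rayPoint l j)
    (h.divisorIdeal_eq_span l) (chi_ne_zero _) n hg
  rw [hfg, this, ← hfg]
  exact_mod_cast hn

lemma ord_chi_rayPoint {m : Fin 3 → ℤ} (hm : m ∈ dualMonoid r a {ρ l}) :
    (Scheme.ord (chartFun j (rayPoint r a (ρ l)) (chi m hm)) (j (rayPoint r a (ρ l))) : ℚ) =
      pair (ρ l) m := by
  obtain ⟨⟨m', hm', he⟩, -⟩ := h.isLeast_ord_rayPoint l j (chi_ne_zero hm)
  rw [Finset.mem_coe, support_chi, Finset.mem_singleton] at hm'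
  rw [← he, hm']

omit [IsNoetherianRing (chartRing r a {ρ l})] in
-- This is the value ε = 1 for a ray: exactly one coordinate vanishes along its divisor, to first
-- order.
lemma sum_pair : ∑ i, pair (ρ l) (μ i) = (1 : ℤ) := by
  simp [h.pair_eq]

end IsDualBasis

lemma r_pos (r a : ℕ) [IsTerminalType r a] : 0 < r :=
  (IsTerminalType.pos (r := r) (a := a)).trans IsTerminalType.lt

section
variable {r a : ℕ} [IsTerminalType r a]

/-- `v` is a ray of the fan. -/
def IsRay (r a : ℕ) (v : Fin 3 → ℚ) : Prop :=
  ∃ c ∈ fanMax r a, v ∈ ({c.1, c.2.1, c.2.2} : Set (Fin 3 → ℚ))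

/-- The one-dimensional cone of a ray. -/
abbrev rayFan {v : Fin 3 → ℚ} (hv : IsRay r a v) : Fan r a :=
  ⟨{v}, hv.choose, hv.choose_spec.1, Set.singleton_subset_iff.2 hv.choose_spec.2⟩

lemma isNoetherianRing_ray {v : Fin 3 → ℚ} (hv : IsRay r a v) :
    IsNoetherianRing (chartRing r a {v}) :=
  isNoetherianRing_of_fg (chartRing_fg r a (rayFan hv))

lemma exists_isDualBasis_ray {v : Fin 3 → ℚ} (hv : IsRay r a v) :
    ∃ ρ μ, ∃ l, IsDualBasis r a ρ μ ∧ v = ρ l := by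
  obtain ⟨ρ, μ, h, hτ⟩ := exists_isDualBasis_fan (rayFan hv)
  obtain ⟨l, hl⟩ := hτ (Set.mem_singleton v)
  exact ⟨ρ, μ, l, h, hl.symm⟩

lemma ray_nonneg {v : Fin 3 → ℚ} (hv : IsRay r a v) : 0 ≤ v :=
  nonneg_of_mem_fan (rayFan hv) (Set.mem_singleton v)

lemma isRay_single (k : Fin 3) : IsRay r a (Pi.single k 1) :=
  (mem_rays_iff _).2 (Or.inl ⟨k, rfl⟩)

lemma isRay_divisorWeight {i : ℕ} (hi : 1 ≤ i) (hi' : i < r) : IsRay r a (divisorWeight r a i) :=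
  (mem_rays_iff _).2 (Or.inr ⟨i, hi, hi', rfl⟩)

/-! ### The pluricanonical form -/

variable (r a) in
/-- The invariant function `xₖ ^ r`. -/
def coordPow (k : Fin 3) : invariants r a :=
  ⟨MvPolynomial.monomial (Finsupp.single k r) 1, by
    rw [mem_invariants]
    intro m hm
    rw [Finset.mem_singleton.1 (MvPolynomial.support_monomial_subset hm)]
    refine Finset.dvd_sum fun i _ => ?_
    by_cases h : k = i
    · subst h; simp
    · simp [h]⟩

lemma toLaurent_coordPow (k : Fin 3) :
    toLaurent (coordPow r a k).1 = AddMonoidAlgebra.single (Pi.single k (r : ℤ)) 1 := by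
  rw [coordPow, toLaurent_monomial]
  congr 1
  funext i
  by_cases h : k = i
  · subst h; simp
  · simp [Ne.symm h]

lemma toChart_coordPow (τ : Fan r a) (k : Fin 3) : toChart r a τ (coordPow r a k) =
    chi _ (single_mem_dualMonoid (fun _ hv => nonneg_of_mem_fan τ hv) k) :=
  Subtype.ext (toLaurent_coordPow (a := a) k)

lemma coordPow_ne_zero (k : Fin 3) : coordPow r a k ≠ 0 := fun h => by
  have := congrArg Subtype.val h
  simp [coordPow] at this

/-- The order of the pluricanonical form along the divisor of a ray. -/
lemma hasPluriformOrder_ray {v : Fin 3 → ℚ} (hv : IsRay r a v) {Z : Scheme.{0}} [IsIntegral Z]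
    [IsLocallyNoetherian Z] (π : Z ⟶ Spec (CommRingCat.of ℂ))
    (j : Spec (CommRingCat.of (chartRing r a {v})) ⟶ Z) [IsOpenImmersion j]
    (hπ : j ≫ π = Spec.map (CommRingCat.ofHom (algebraMap ℂ (chartRing r a {v}))))
    {b : Fin 3 → Z.functionField}
    (hb : ∀ k, b k = chartFun j (rayPoint r a v) (toChart r a (rayFan hv) (coordPow r a k)))
    {h : Z.functionField} (hh : h * (∏ k, b k) ^ (r - 1) = 1) {n : ℤ}
    (hn : (n : ℚ) = r * (∑ k, v k - 1)) :
    HasPluriformOrder π r h b (j (rayPoint r a v)) n := by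
  have := isNoetherianRing_ray hv
  obtain ⟨ρ, μ, l, hB, rfl⟩ := exists_isDualBasis_ray hv
  have hpos : ∀ u ∈ ({ρ l} : Set (Fin 3 → ℚ)), 0 ≤ u := fun u hu => by
    rw [Set.mem_singleton_iff.1 hu]; exact ray_nonneg hv
  refine hasPluriformOrder_chart j (rayPoint r a (ρ l)) (r_pos r a) hπ hB (by simp) hpos
    (fun m hm => hB.ord_chi_rayPoint l j hm) (ε := 1) (hB.sum_pair l) (fun k => ?_) hh
    (by simpa using hn)
  rw [hb, toChart_coordPow]

/-- The pluricanonical form has order zero on the torus. -/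
lemma hasPluriformOrder_torus {Z : Scheme.{0}} [IsIntegral Z] [IsLocallyNoetherian Z]
    (π : Z ⟶ Spec (CommRingCat.of ℂ)) (j : Spec (CommRingCat.of (chartRing r a ∅)) ⟶ Z)
    [IsOpenImmersion j]
    (hπ : j ≫ π = Spec.map (CommRingCat.ofHom (algebraMap ℂ (chartRing r a ∅))))
    (p : Spec (CommRingCat.of (chartRing r a ∅))) {b : Fin 3 → Z.functionField}
    (hb : ∀ k, b k = chartFun j p (toChart r a (Fan.zero r a) (coordPow r a k)))
    {h : Z.functionField} (hh : h * (∏ k, b k) ^ (r - 1) = 1) :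
    HasPluriformOrder π r h b (j p) 0 := by
  obtain ⟨ρ, μ, hB, -⟩ := exists_isDualBasis_fan (Fan.zero r a)
  -- On the torus all monomials are units, so orders are given by the zero vector, at every point
  -- `p`.
  refine hasPluriformOrder_chart j p (r_pos r a) hπ hB (Set.empty_subset _) (by simp) (v := 0)
    (ε := 0) (fun m hm => ?_) (by simp [pair]) (fun k => ?_) hh (by simp)
  · rw [ord_chartFun_of_isUnit j p (isUnit_chi_torus hm)]
    simp [pair]
  · rw [hb, toChart_coordPow]
    rfl

/-! ### Points of codimension one -/

lemma chartι_face {τ σ : Fan r a} (h : τ ≤ σ) (x : Spec (CommRingCat.of (chartRing r a τ.1))) :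
    chartι r a σ (Spec.map (CommRingCat.ofHom (faceHom h)) x) = chartι r a τ x := by
  have : (diagram r a).map (homOfLE h) ≫ chartι r a σ = chartι r a τ :=
    colimit.w (diagram r a) (homOfLE h)
  exact congrArg (fun g => g.base x) this

/-- The prime divisors of `Y` are those of the torus and those of the rays. -/
lemma exists_of_coheight_eq_one (y : economicResolution r a) (hy : Order.coheight y = 1) :
    (∃ Q, chartι r a (Fan.zero r a) Q = y) ∨
      ∃ v, ∃ hv : IsRay r a v, chartι r a (rayFan hv) (rayPoint r a v) = y := by
  obtain ⟨τ, x, rfl⟩ := chartι_surj r a y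
  have h0 : Fan.zero r a ≤ τ := Set.empty_subset _
  -- Taking the zero cone as face yields an exponent that is at least 1 on every ray of `τ`.
  obtain ⟨m, hm, -, hm1⟩ := exists_face h0
  rcases exists_face_of_height_eq_one τ.finite hm (fun v hv => hm1 v hv (Set.notMem_empty v)) x
    ((coheight_chart (chartι r a τ) x).symm.trans hy) with ⟨Q, rfl⟩ | ⟨v, hv, rfl⟩
  · exact Or.inl ⟨Q, (chartι_face h0 Q).symm⟩
  · right
    obtain ⟨c, hc, hcτ⟩ := τ.2
    have hr : IsRay r a v := ⟨c, hc, hcτ hv⟩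
    have hle : rayFan hr ≤ τ := Set.singleton_subset_iff.2 hv
    exact ⟨v, hr, (chartι_face hle (rayPoint r a v)).symm⟩

/-! ### The resolution morphism on charts, and X as the chart of the octant -/

lemma chartι_resolution (τ : Fan r a) : chartι r a τ ≫ resolution r a =
    Spec.map (CommRingCat.ofHom (toChart r a τ).toRingHom) :=
  colimit.ι_desc _ _

lemma toChart_structX (τ : Fan r a) :
    Spec.map (CommRingCat.ofHom (toChart r a τ).toRingHom) ≫ structX r a =
      Spec.map (CommRingCat.ofHom (algebraMap ℂ (chartRing r a τ.1))) := by
  rw [← Spec.map_comp, ← CommRingCat.ofHom_comp]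
  congr 2
  exact (toChart r a τ).comp_algebraMap

lemma chartι_structX (τ : Fan r a) : chartι r a τ ≫ resolution r a ≫ structX r a =
    Spec.map (CommRingCat.ofHom (algebraMap ℂ (chartRing r a τ.1))) := by
  rw [← Category.assoc, chartι_resolution, toChart_structX]

lemma singleton_subset_octant (k : Fin 3) : {(Pi.single k 1 : Fin 3 → ℚ)} ⊆ octant :=
  Set.singleton_subset_iff.2 ⟨k, rfl⟩

/-- The octant is not smooth for M, so the exponents of `exists_face` are unavailable. The product
of the x_k^r over the coordinate rays outside `τ` lies in M and serves instead. -/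
lemma isOpenImmersion_faceHom {τ : Set (Fin 3 → ℚ)} (hτ : τ ⊆ octant) :
    IsOpenImmersion (Spec.map (CommRingCat.ofHom (faceHom (r := r) (a := a) hτ))) := by
  classical
  let m : Fin 3 → ℤ := fun k => if (Pi.single k 1 : Fin 3 → ℚ) ∈ τ then 0 else r
  have hm : m ∈ latticeM r a := by
    change (r : ℤ) ∣ ∑ i, weight a i * m i
    refine Finset.dvd_sum fun i _ => Dvd.dvd.mul_left ?_ _
    simp only [m]
    split_ifs <;> simp
  have h0 : ∀ v ∈ τ, pair v m = 0 := by
    intro v hv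
    obtain ⟨k, rfl⟩ := hτ hv
    rw [pair_single]
    simp only [m, if_pos hv, Int.cast_zero]
  have h1 : ∀ v ∈ octant, v ∉ τ → 1 ≤ pair v m := by
    rintro _ ⟨k, rfl⟩ hv
    rw [pair_single]
    simp only [m, if_neg hv]
    exact_mod_cast r_pos r a
  let _ := (faceHom (r := r) (a := a) hτ).toAlgebra
  have : IsLocalization.Away (chi m (face_mem hm h0 h1)) (chartRing r a τ) :=
    isLocalization_face hτ hm h0 h1 (face_mem hm h0 h1) (Set.finite_range _)
  exact IsOpenImmersion.of_isLocalization (chi m (face_mem hm h0 h1))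

variable (r a) in
/-- The chart of the octant is all of `X`. -/
def octantι : Spec (CommRingCat.of (chartRing r a octant)) ⟶ quotient r a :=
  Spec.map (CommRingCat.ofHom (octantEquiv r a).toRingEquiv.toRingHom)

instance : IsIso (octantι r a) := by
  have : IsIso (CommRingCat.ofHom (octantEquiv r a).toRingEquiv.toRingHom) :=
    (octantEquiv r a).toRingEquiv.toCommRingCatIso.isIso_hom
  exact inferInstanceAs (IsIso (Spec.map _))

lemma toChart_octant (τ : Fan r a) (hτ : τ.1 ⊆ octant) :
    Spec.map (CommRingCat.ofHom (toChart r a τ).toRingHom) =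
      Spec.map (CommRingCat.ofHom (faceHom hτ)) ≫ octantι r a := by
  rw [octantι, ← Spec.map_comp, ← CommRingCat.ofHom_comp, toChart_eq τ hτ]

lemma isOpenImmersion_toChart (τ : Fan r a) (hτ : τ.1 ⊆ octant) :
    IsOpenImmersion (Spec.map (CommRingCat.ofHom (toChart r a τ).toRingHom)) := by
  rw [toChart_octant τ hτ]
  have := isOpenImmersion_faceHom (r := r) (a := a) hτ
  infer_instance

/-- The prime divisors of `X` are those of the torus and the coordinate divisors. -/
lemma exists_of_coheight_eq_one_quotient (x : quotient r a) (hx : Order.coheight x = 1) :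
    (∃ Q, Spec.map (CommRingCat.ofHom (toChart r a (Fan.zero r a)).toRingHom) Q = x) ∨
      ∃ k, Spec.map (CommRingCat.ofHom (toChart r a (rayFan (isRay_single k))).toRingHom)
        (rayPoint r a (Pi.single k 1)) = x := by
  obtain ⟨x, rfl⟩ : ∃ x', octantι r a x' = x := (octantι r a).surjective x
  -- The invariant monomial (xyz)^r is positive on all three rays.
  have hm : (fun _ => (r : ℤ)) ∈ latticeM r a :=
    Finset.dvd_sum (f := fun i => weight a i * (r : ℤ)) fun i _ => Dvd.intro_left _ rfl
  have hpos : ∀ v ∈ octant, 1 ≤ pair v (fun _ => (r : ℤ)) := by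
    rintro _ ⟨k, rfl⟩
    rw [pair_single]
    exact_mod_cast r_pos r a
  rcases exists_face_of_height_eq_one (Set.finite_range _) hm hpos x
    ((coheight_chart (octantι r a) x).symm.trans hx) with ⟨Q, rfl⟩ | ⟨_, ⟨k, rfl⟩, rfl⟩
  · refine Or.inl ⟨Q, ?_⟩
    rw [toChart_octant _ (Set.empty_subset _)]
    rfl
  · refine Or.inr ⟨k, ?_⟩
    rw [toChart_octant _ (singleton_subset_octant k)]
    rfl

lemma resolution_chartι (τ : Fan r a) (x : Spec (CommRingCat.of (chartRing r a τ.1))) :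
    resolution r a (chartι r a τ x) =
      Spec.map (CommRingCat.ofHom (toChart r a τ).toRingHom) x :=
  congrArg (fun g => g.base x) (chartι_resolution τ)

/-- On the charts of the faces of the octant, `f` preserves codimensions. -/
lemma coheight_resolution (τ : Fan r a) (hτ : τ.1 ⊆ octant)
    (x : Spec (CommRingCat.of (chartRing r a τ.1))) :
    Order.coheight (resolution r a (chartι r a τ x)) = Order.coheight (chartι r a τ x) := by
  have := isOpenImmersion_toChart τ hτ
  rw [resolution_chartι, coheight_chart, coheight_chart]

lemma pullbackFunction_eq (τ : Fan r a) (x : Spec (CommRingCat.of (chartRing r a τ.1)))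
    (g : invariants r a) :
    pullbackFunction r a g = chartFun (chartι r a τ) x (toChart r a τ g) := by
  refine germ_eq_chartFun (chartι r a τ) x ?_
  change ((resolution r a).appTop ≫ (chartι r a τ).appTop) _ = _
  rw [← Scheme.Hom.comp_appTop, chartι_resolution]
  exact ConcreteCategory.congr_hom (Scheme.ΓSpecIso_inv_naturality
    (CommRingCat.ofHom (toChart r a τ).toRingHom)).symm g

lemma germ_quotient_eq (τ : Fan r a) (hτ : τ.1 ⊆ octant)
    (x : Spec (CommRingCat.of (chartRing r a τ.1))) (g : invariants r a) :
    haveI := isOpenImmersion_toChart τ hτ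
    (quotient r a).presheaf.germ ⊤ (genericPoint (quotient r a)) trivial
      ((Scheme.ΓSpecIso (CommRingCat.of (invariants r a))).inv g) =
      chartFun (Spec.map (CommRingCat.ofHom (toChart r a τ).toRingHom)) x (toChart r a τ g) := by
  have := isOpenImmersion_toChart τ hτ
  refine germ_eq_chartFun _ x ?_
  exact ConcreteCategory.congr_hom (Scheme.ΓSpecIso_inv_naturality
    (CommRingCat.ofHom (toChart r a τ).toRingHom)).symm g

end


section
variable {r a : ℕ} [IsTerminalType r a]

/-! ### The exceptional divisors -/

lemma coheight_ray {v : Fin 3 → ℚ} (hv : IsRay r a v) :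
    Order.coheight (chartι r a (rayFan hv) (rayPoint r a v)) = 1 := by
  have := isNoetherianRing_ray hv
  have hj : IsOpenImmersion (chartι r a (rayFan hv)) := inferInstance
  generalize chartι r a (rayFan hv) = j at hj
  obtain ⟨ρ, μ, l, hB, rfl⟩ := exists_isDualBasis_ray hv
  exact hB.coheight_rayPoint l j

lemma isLeast_ord_chartFun_ray {v : Fin 3 → ℚ} (hv : IsRay r a v) {Z : Scheme.{0}}
    [IsIntegral Z] [IsLocallyNoetherian Z] (j : Spec (CommRingCat.of (chartRing r a {v})) ⟶ Z)
    [IsOpenImmersion j] {f : chartRing r a {v}} (hf : f ≠ 0) :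
    IsLeast (pair v '' f.1.coeff.support)
      (Scheme.ord (chartFun j (rayPoint r a v) f) (j (rayPoint r a v)) : ℚ) := by
  have := isNoetherianRing_ray hv
  obtain ⟨ρ, μ, l, hB, rfl⟩ := exists_isDualBasis_ray hv
  exact hB.isLeast_ord_rayPoint l j hf

lemma isLeast_ord_ray {v : Fin 3 → ℚ} (hv : IsRay r a v) {g : invariants r a} (hg : g ≠ 0) :
    IsLeast ((fun m : Fin 3 →₀ ℕ => ∑ j, v j * m j) '' g.1.support)
      (Scheme.ord (pullbackFunction r a g)
        (chartι r a (rayFan hv) (rayPoint r a v)) : ℚ) := by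
  rw [pullbackFunction_eq (rayFan hv) (rayPoint r a v)]
  have hg' : toChart r a (rayFan hv) g ≠ 0 := fun h0 => by
    have h1 : toLaurent g.1 = 0 := congrArg Subtype.val h0
    exact hg (Subtype.ext (toLaurent_injective (h1.trans (map_zero _).symm)))
  have hs : (fun m : Fin 3 →₀ ℕ => ∑ j, v j * m j) '' (g.1.support : Set (Fin 3 →₀ ℕ)) =
      pair v '' ((toChart r a (rayFan hv) g).1.coeff.support : Set (Fin 3 → ℤ)) := by
    change _ = pair v '' ((toLaurent g.1).coeff.support : Set (Fin 3 → ℤ))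
    rw [support_toLaurent, Set.image_image]
    simp [pair]
  rw [hs]
  exact isLeast_ord_chartFun_ray hv (chartι r a (rayFan hv)) hg'

/-- For k = 2 and the ray of index i this order is i, so the function z^r tells the exceptional
divisors apart. -/
lemma ord_coordPow_ray {v : Fin 3 → ℚ} (hv : IsRay r a v) (k : Fin 3) :
    (Scheme.ord (pullbackFunction r a (coordPow r a k))
      (chartι r a (rayFan hv) (rayPoint r a v)) : ℚ) = r * v k := by
  obtain ⟨⟨m, hm, he⟩, -⟩ := isLeast_ord_ray hv (coordPow_ne_zero k)
  have : m = Finsupp.single k r := Finset.mem_singleton.1 (MvPolynomial.support_monomial_subset hm)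
  rw [← he, this]
  simp [Finsupp.single_apply, mul_comm]

lemma divisorWeight_pos {i : ℕ} (hi : 1 ≤ i) (hi' : i < r) (k : Fin 3) :
    0 < divisorWeight r a i k := by
  have h0 : 0 < i * a % r := Nat.pos_of_ne_zero (mul_mod_ne_zero (a := a) hi hi')
  have h1 : i * a % r < r := Nat.mod_lt _ (by omega)
  have hr : (0 : ℚ) < r := by exact_mod_cast r_pos r a
  have h0' : (0 : ℚ) < (i * a % r : ℕ) := by exact_mod_cast h0
  have h1' : ((i * a % r : ℕ) : ℚ) < r := by exact_mod_cast h1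
  have hi0 : (0 : ℚ) < i := by exact_mod_cast hi
  rw [divisorWeight_eq hi hi']
  fin_cases k
  · exact div_pos h0' hr
  · exact div_pos (sub_pos.2 h1') hr
  · exact div_pos hi0 hr

lemma sum_divisorWeight {i : ℕ} (hi : 1 ≤ i) (hi' : i < r) :
    ∑ k, divisorWeight r a i k = 1 + (i : ℚ) / r := by
  have hr : (r : ℚ) ≠ 0 := by exact_mod_cast (r_pos r a).ne'
  rw [divisorWeight_eq hi hi', Fin.sum_univ_three]
  simp only [Matrix.cons_val]
  field_simp
  ring

/-- The divisor of a ray in the interior of the octant is contracted to a point of codimension at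
least two. -/
lemma one_lt_coheight_resolution {v : Fin 3 → ℚ} (hv : IsRay r a v) (hpos : ∀ k, 0 < v k) :
    1 < Order.coheight (resolution r a (chartι r a (rayFan hv) (rayPoint r a v))) := by
  have hr : (0 : ℚ) < r := by exact_mod_cast r_pos r a
  rw [resolution_chartι, ← idealHeight_eq_coheight]
  let P : Ideal (invariants r a) :=
    (divisorIdeal r a (Set.mem_singleton v)).comap (toChart r a (rayFan hv)).toRingHom
  change 1 < P.height
  have hP : P.IsPrime := Ideal.comap_isPrime _ _
  have hmem : (Pi.single 0 1 : Fin 3 → ℚ) ∈ octant := ⟨0, rfl⟩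
  -- The prime of the divisor x = 0 of X provides the chain 0 < Q < P, with x^r in Q and y^r in P
  -- but not in Q.
  let Q : Ideal (invariants r a) := (divisorIdeal r a hmem).comap (toOctant r a).toRingHom
  have hQ : Q.IsPrime := Ideal.comap_isPrime _ _
  have hsupp : ∀ k : Fin 3, (toLaurent (coordPow r a k).1).coeff.support =
      {Pi.single k (r : ℤ)} := fun k => by
    rw [toLaurent_coordPow]
    exact Finsupp.support_single (hb := one_ne_zero) ..
  have hQ0 : coordPow r a 0 ∈ Q := by
    intro m hm
    change m ∈ (toLaurent (coordPow r a 0).1).coeff.support at hm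
    rw [hsupp, Finset.mem_singleton] at hm
    rw [hm, pair_single_right]
    simpa using hr
  have hQ1 : coordPow r a 1 ∉ Q := by
    intro h
    have := h (Pi.single 1 (r : ℤ)) (by
      change _ ∈ (toLaurent (coordPow r a 1).1).coeff.support
      rw [hsupp, Finset.mem_singleton])
    rw [pair_single_right] at this
    simp at this
  have hP1 : coordPow r a 1 ∈ P := by
    intro m hm
    change m ∈ (toLaurent (coordPow r a 1).1).coeff.support at hm
    rw [hsupp, Finset.mem_singleton] at hm
    rw [hm, pair_single_right]
    exact mul_pos (hpos 1) (by exact_mod_cast hr)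
  -- A monomial divisible by x pairs positively with `v`, because all coordinates of `v` are
  -- positive.
  have hle : Q ≤ P := by
    intro f hf m hm
    have h1 : 0 < pair (Pi.single 0 1) m := hf m hm
    obtain ⟨n, hn, rfl⟩ := exists_of_mem_support_toLaurent (f := f.1) hm
    rw [pair_single] at h1
    exact Finset.sum_pos' (fun k _ => mul_nonneg (hpos k).le (by positivity))
      ⟨0, Finset.mem_univ _, mul_pos (hpos 0) h1⟩
  have hlt : Q < P := lt_of_le_of_ne hle fun h => hQ1 (h ▸ hP1)
  have hbot : (⊥ : Ideal (invariants r a)) < Q := by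
    rw [bot_lt_iff_ne_bot]
    intro h0
    rw [h0] at hQ0
    exact coordPow_ne_zero 0 hQ0
  have h1 := Ideal.height_add_one_le_of_lt_of_isPrime hbot
  have h2 := Ideal.height_add_one_le_of_lt_of_isPrime hlt
  have h3 := (add_le_add_left (le_add_self.trans h1) 1).trans h2
  exact lt_of_lt_of_le (by decide) h3

/-! ### The discrepancies -/

/-- Stated at a point equal to the generic point because it is applied in the stalk of X at the
image of the generic point of Y; it lets the monomial (xyz)^{r(r-1)} be inverted there. -/
lemma isUnit_germ_of_eq_genericPoint {X : Scheme.{0}} [IsIntegral X] {x : X}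
    (hx : x = genericPoint X) {s : Γ(X, ⊤)} (hs : s ≠ 0) :
    IsUnit (X.presheaf.germ ⊤ x trivial s) := by
  subst hx
  have : X.presheaf.germ ⊤ (genericPoint X) trivial s ≠ 0 :=
    (map_ne_zero_iff _ (germ_injective_of_isIntegral X (U := ⊤) _ trivial)).2 hs
  exact (isUnit_iff_ne_zero (G₀ := X.functionField)).2 this

variable (r a) in
-- Both generic points come from the generic point of the common torus, which is open in Y and in X.
lemma resolution_genericPoint :
    resolution r a (genericPoint (economicResolution r a)) = genericPoint (quotient r a) := by
  have h0 : (Fan.zero r a).1 ⊆ octant := Set.empty_subset _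
  have := isOpenImmersion_toChart (Fan.zero r a) h0
  rw [← genericPoint_eq_of_isOpenImmersion (chartι r a (Fan.zero r a)), resolution_chartι,
    genericPoint_eq_of_isOpenImmersion]

lemma hasDiscrepancy_ray {v : Fin 3 → ℚ} (hv : IsRay r a v) {i : ℕ}
    (hsum : ∑ k, v k = 1 + (i : ℚ) / r) :
    HasDiscrepancy (structX r a) (resolution r a)
      (chartι r a (rayFan hv) (rayPoint r a v)) ((i : ℚ) / r) := by
  have hr : (r : ℚ) ≠ 0 := by exact_mod_cast (r_pos r a).ne'
  let s : invariants r a → Γ(quotient r a, ⊤) := fun g =>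
    (Scheme.ΓSpecIso (CommRingCat.of (invariants r a))).inv g
  let G := (quotient r a).presheaf.germ ⊤
    (resolution r a (genericPoint (economicResolution r a))) trivial
  have hs : s ((∏ k, coordPow r a k) ^ (r - 1)) ≠ 0 := by
    have hinj : Function.Injective (Scheme.ΓSpecIso (CommRingCat.of (invariants r a))).inv :=
      ((ConcreteCategory.isIso_iff_bijective _).1 inferInstance).1
    rw [map_ne_zero_iff _ hinj]
    exact pow_ne_zero _ (Finset.prod_ne_zero_iff.2 fun k _ => coordPow_ne_zero k)
  -- The factor h = (xyz)^{-r(r-1)} cancels what the differentials of the x_k^r contribute beyond dx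
  -- ∧ dy ∧ dz.
  obtain ⟨h, hh⟩ := (isUnit_germ_of_eq_genericPoint (resolution_genericPoint r a) hs).exists_left_inv
  have hh' : h * (∏ k, G (s (coordPow r a k))) ^ (r - 1) = 1 := by
    rw [← hh]
    simp only [s, map_pow, map_prod]
    rfl
  refine ⟨r, h, fun k => G (s (coordPow r a k)), i, r_pos r a, fun x hx _ => ?_, ?_, ?_⟩
  -- On X the order is zero along every prime divisor: on the torus, and along a coordinate divisor
  -- because the coordinate sum is 1.
  · have hb : ∀ g, algebraMap _ (quotient r a).functionField (G (s g)) =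
        (quotient r a).presheaf.germ ⊤ (genericPoint (quotient r a)) trivial (s g) := fun g => by
      have : Nonempty (⊤ : (quotient r a).Opens) :=
        ⟨⟨genericPoint (quotient r a), trivial⟩⟩
      exact Scheme.algebraMap_germ_eq_germToFunctionField (X := quotient r a) (U := ⊤) trivial _
    have hhX : algebraMap _ (quotient r a).functionField h *
        (∏ k, algebraMap _ (quotient r a).functionField (G (s (coordPow r a k)))) ^ (r - 1) = 1 := by
      rw [← map_prod, ← map_pow, ← map_mul, hh', map_one]
    rcases exists_of_coheight_eq_one_quotient x hx with ⟨Q, rfl⟩ | ⟨k, rfl⟩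
    · have h0 : (Fan.zero r a).1 ⊆ octant := Set.empty_subset _
      let j : Spec (CommRingCat.of (chartRing r a ∅)) ⟶ quotient r a :=
        Spec.map (CommRingCat.ofHom (toChart r a (Fan.zero r a)).toRingHom)
      have : IsOpenImmersion j := isOpenImmersion_toChart (Fan.zero r a) h0
      refine hasPluriformOrder_torus (structX r a) j (toChart_structX (Fan.zero r a)) Q (fun l => ?_) hhX
      exact (hb _).trans (germ_quotient_eq (Fan.zero r a) h0 Q _)
    · have h0 : (rayFan (isRay_single (r := r) (a := a) k)).1 ⊆ octant := singleton_subset_octant k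
      have := isOpenImmersion_toChart (rayFan (isRay_single k)) h0
      refine hasPluriformOrder_ray (isRay_single k) _ _ (toChart_structX (rayFan (isRay_single k)))
        (fun l => ?_) hhX (by simp)
      exact (hb _).trans (germ_quotient_eq (rayFan (isRay_single k)) h0 _ _)
  -- On Y the order is r(1 + i/r - 1) = i.
  · have hb : ∀ g, ((resolution r a).stalkMap (genericPoint (economicResolution r a))).hom
        (G (s g)) = pullbackFunction r a g := fun g =>
      Scheme.Hom.germ_stalkMap_apply (resolution r a) ⊤ _ trivial (s g)
    refine hasPluriformOrder_ray hv _ _ (chartι_structX (rayFan hv)) (fun l => ?_) ?_ ?_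
    · exact (hb _).trans (pullbackFunction_eq (rayFan hv) (rayPoint r a v) _)
    · rw [← map_prod, ← map_pow, ← map_mul, hh', map_one]
    · rw [hsum]
      push_cast
      field_simp
      ring
  · push_cast
    field_simp

/-! ### Labelling the exceptional divisors -/

variable (r a) in
/-- The generic point of the divisor of the ray `(1/r)(i a mod r, -i a mod r, i)`. -/
def divisorPoint (i : ℕ) : economicResolution r a :=
  if h : 1 ≤ i ∧ i < r then
    chartι r a (rayFan (isRay_divisorWeight h.1 h.2)) (rayPoint r a (divisorWeight r a i))
  else genericPoint _

lemma divisorPoint_eq {i : ℕ} (hi : 1 ≤ i) (hi' : i < r) : divisorPoint r a i =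
    chartι r a (rayFan (isRay_divisorWeight hi hi')) (rayPoint r a (divisorWeight r a i)) :=
  dif_pos ⟨hi, hi'⟩

lemma bijOn_divisorPoint : Set.BijOn (divisorPoint r a) (Set.Ico 1 r)
    {y | IsExceptionalDivisor (resolution r a) y} := by
  refine ⟨?_, ?_, ?_⟩
  · rintro i ⟨hi, hi'⟩
    rw [divisorPoint_eq hi hi']
    exact ⟨coheight_ray _, one_lt_coheight_resolution _ (divisorWeight_pos hi hi')⟩
  -- Injectivity: the order of z^r recovers the index.
  · rintro i ⟨hi, hi'⟩ k ⟨hk, hk'⟩ h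
    have h1 := ord_coordPow_ray (isRay_divisorWeight (a := a) hi hi') 2
    have h2 := ord_coordPow_ray (isRay_divisorWeight (a := a) hk hk') 2
    rw [divisorPoint_eq hi hi', divisorPoint_eq hk hk'] at h
    rw [h, h2, divisorWeight_eq hi hi', divisorWeight_eq hk hk'] at h1
    simp only [Matrix.cons_val] at h1
    have hr : (r : ℚ) ≠ 0 := by exact_mod_cast (r_pos r a).ne'
    rw [mul_div_cancel₀ _ hr, mul_div_cancel₀ _ hr] at h1
    exact_mod_cast h1.symm
  · rintro y ⟨hy, hy'⟩
    -- A chart whose rays are coordinate vectors maps to X by an open immersion, which preserves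
    -- codimension; so it carries no exceptional divisor.
    have hoct : ∀ (τ : Fan r a) (_ : τ.1 ⊆ octant) (x), y ≠ chartι r a τ x := by
      rintro τ hτ x rfl
      rw [coheight_resolution τ hτ, hy] at hy'
      exact lt_irrefl _ hy'
    rcases exists_of_coheight_eq_one y hy with ⟨Q, rfl⟩ | ⟨v, hv, rfl⟩
    · exact absurd rfl (hoct (Fan.zero r a) (Set.empty_subset _) Q)
    · rcases (mem_rays_iff v).1 hv with ⟨k, rfl⟩ | ⟨i, hi, hi', rfl⟩
      · exact absurd rfl (hoct (rayFan hv) (singleton_subset_octant k) _)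
      · exact ⟨i, ⟨hi, hi'⟩, divisorPoint_eq hi hi'⟩

end

end CyclicQuotient
end

open AlgebraicGeometry CyclicQuotient in
theorem proposition3p1 (r a : ℕ) [IsTerminalType r a] :
    ∃ E : ℕ → economicResolution r a,
      Set.BijOn E (Set.Ico 1 r) {y | IsExceptionalDivisor (resolution r a) y} ∧
      ∀ i ∈ Set.Ico 1 r,
        HasDiscrepancy (structX r a) (resolution r a) (E i) ((i : ℚ) / r) ∧
        ∀ g : invariants r a, g ≠ 0 →
          IsLeast ((fun m : Fin 3 →₀ ℕ => ∑ j, divisorWeight r a i j * m j) '' g.1.support)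
            (Scheme.ord (pullbackFunction r a g) (E i) : ℚ) := by
  refine ⟨divisorPoint r a, bijOn_divisorPoint, ?_⟩
  rintro i ⟨hi, hi'⟩
  rw [divisorPoint_eq hi hi']
  exact ⟨hasDiscrepancy_ray _ (sum_divisorWeight hi hi'), fun g hg => isLeast_ord_ray _ hg⟩
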